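/- All quantum systems are finite-dimensional and all outcome sets are finite. Let $S$ be a system of dimension $d\ge 1$, and let $\mathcal M=\{\mathcal M^m\}_m$ be a quantum instrument (completely positive maps $\mathcal M^m$ from operators on $S$ to operators on an output system $S'$, whose sum is trace-preserving). Write $\mathcal M(\rho)=\sum_m\mathcal M^m(\rho)\otimes|m\rangle\langle m|$, and let $\mathcal E$ be any completely positive trace-preserving map (a correction) from $S'\otimes M$, with $M$ the outcome register, to $S$. Let $X=\sum_x\xi_x|\psi^x\rangle\langle\psi^x|$ and $Z=\sum_z\zeta_z|\varphi^z\rangle\langle\varphi^z|$ be nondegenerate observables on $S$, let $c=\max_{x,z}|\langle\psi^x|\varphi^z\rangle|^2$, and let $f$ be any real-valued estimate of $X$ from the outcome $m$. Define the mean-square-deviation noise and disturbance by $$V_{\mathsf N}^X=\sum_{m,x}p(m,x)\,[f(m)-\xi_x]^2,\qquad p(m,x)=\tfrac1d\operatorname{Tr}\big[\mathcal M^m(|\psi^x\rangle\langle\psi^x|)\big],$$ $$V_{\mathsf D}^Z=\sum_{\hat z,z}p(\hat z,z)\,[\zeta_{\hat z}-\zeta_z]^2,\qquad p(\hat z,z)=\tfrac1d\langle\varphi^{\hat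 z}|(\mathcal E\circ\mathcal M)(|\varphi^z\rangle\langle\varphi^z|)|\varphi^{\hat z}\rangle .$$ (1) If all differences of eigenvalues of $X$ are integer multiples of $s_X\in\mathbb R$ and all differences of eigenvalues of $Z$ are integer multiples of $s_Z\in\mathbb R$, then $$\Big[V_{\mathsf N}^X+\frac{s_X^2}{12}\Big]\Big[V_{\mathsf D}^Z+\frac{s_Z^2}{12}\Big]\ \ge\ \Big(\frac{s_Xs_Z}{2\pi e\,c}\Big)^2 .$$ (2) Consider a measuring process on $S$: a finite-dimensional probe $K$ in a state $\sigma$, a unitary $U$ on $S\otimes K$, and a projective measurement $\{P_m\}$ on $K$; it implements the maps $\rho\mapsto\operatorname{Tr}_K[(1\otimes P_m)U(\rho\otimes\sigma)U^\dagger(1\otimes P_m)]$. Ozawa's noise and disturbance in a state $\rho$ are $\epsilon(X,\rho)=\operatorname{Tr}[N^2(\rho\otimes\sigma)]^{1/2}$ with $N=U^\dagger\big(1\otimes\sum_mf(m)P_m\big)U-X\otimes1$, and $\eta(Z,\rho)=\operatorname{Tr}[D^2(\rho\otimes\sigma)]^{1/2}$ with $D=U^\dagger(Z\otimes1)U-Z\otimes1$.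 Then $V_{\mathsf N}^X=\epsilon(X,d^{-1}1)^2$ for every measuring process whose outcome statistics are those of $\mathcal M$ in every input state, and $V_{\mathsf D}^Z=\eta(Z,d^{-1}1)^2$ for every measuring process whose maps sum to $\mathcal E\circ\mathcal M$. There is a measuring process that implements $\rho\mapsto\mathcal E(\mathcal M^m(\rho)\otimes|m\rangle\langle m|)$ for every $m$; both equalities hold for it. (3) If $S$ is a qubit, $X=\sigma_X$ and $Z=\sigma_Z$ (Pauli matrices), and $V_{\mathsf N}^X=0$ for some instrument $\mathcal M$ and estimate $f$, then $V_{\mathsf D}^Z=2$ for every correction $\mathcal E$. -/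

import Mathlib

open scoped Matrix Kronecker ComplexOrder

noncomputable section

namespace NoiseDisturbance

/-!  Finite-dimensional quantum systems: the Hilbert space with index type `S` is
`EuclideanSpace ℂ S`, and operators on it are matrices `Matrix S S ℂ`. The composite of two
systems has the product index type and the Kronecker product of operators. -/

/-- The rank-one operator `|v⟩⟨v|`. -/
def ketbra {S : Type*} (v : EuclideanSpace ℂ S) : Matrix S S ℂ :=
  Matrix.vecMulVec v.ofLp (star v.ofLp)

/-- The ampliation `Φ ⊗ id` of a linear map `Φ` of operators by an ancilla with index type `R`. -/
def ampliation {A B R : Type*} (Φ : Matrix A A ℂ →ₗ[ℂ] Matrix B B ℂ)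
    (T : Matrix (A × R) (A × R) ℂ) : Matrix (B × R) (B × R) ℂ :=
  Matrix.of fun p q => Φ (Matrix.of fun i j => T (i, p.2) (j, q.2)) p.1 q.1

/-- Complete positivity: `Φ ⊗ id_k` maps positive semidefinite operators to positive semidefinite
operators, for every ancilla dimension `k`. -/
def IsCompletelyPositive {A B : Type*} (Φ : Matrix A A ℂ →ₗ[ℂ] Matrix B B ℂ) : Prop :=
  ∀ (k : ℕ) (T : Matrix (A × Fin k) (A × Fin k) ℂ), T.PosSemidef → (ampliation Φ T).PosSemidef

/-- A quantum channel (completely positive trace-preserving map) from system `A` to system `B`. -/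
structure Channel (A B : Type*) [Fintype A] [Fintype B] where
  map : Matrix A A ℂ →ₗ[ℂ] Matrix B B ℂ
  completelyPositive : IsCompletelyPositive map
  trace_map : ∀ ρ : Matrix A A ℂ, (map ρ).trace = ρ.trace

/-- A quantum instrument from system `S` to system `S'` with outcomes in `M`: completely positive
maps indexed by the outcomes, whose sum preserves the trace. -/
structure Instrument (S S' M : Type*) [Fintype S] [Fintype S'] [Fintype M] where
  op : M → Matrix S S ℂ →ₗ[ℂ] Matrix S' S' ℂ
  completelyPositive : ∀ m, IsCompletelyPositive (op m)
  trace_sum : ∀ ρ : Matrix S S ℂ, (∑ m, op m ρ).trace = ρ.trace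

/-- The operator `𝓘^m(ρ) ⊗ |m⟩⟨m|` on the output system together with the outcome register. -/
def Instrument.flagged {S S' M : Type*} [Fintype S] [Fintype S'] [Fintype M] [DecidableEq M]
    (𝓘 : Instrument S S' M) (m : M) (ρ : Matrix S S ℂ) : Matrix (S' × M) (S' × M) ℂ :=
  𝓘.op m ρ ⊗ₖ Matrix.single m m (1 : ℂ)

/-- The instrument as one map with a classical and a quantum output:
`ρ ↦ ∑ m, 𝓘^m(ρ) ⊗ |m⟩⟨m|`. -/
def Instrument.channel {S S' M : Type*} [Fintype S] [Fintype S'] [Fintype M] [DecidableEq M]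
    (𝓘 : Instrument S S' M) (ρ : Matrix S S ℂ) : Matrix (S' × M) (S' × M) ℂ :=
  ∑ m, 𝓘.flagged m ρ

/-- A nondegenerate observable: an orthonormal basis of eigenstates with distinct real
eigenvalues. -/
structure Observable (S : Type*) [Fintype S] where
  eigenstate : OrthonormalBasis S ℂ (EuclideanSpace ℂ S)
  eigenvalue : S → ℝ
  nondegenerate : Function.Injective eigenvalue

/-- The self-adjoint operator `∑ x, ξ_x |ψ^x⟩⟨ψ^x|` of an observable. -/
def Observable.toMatrix {S : Type*} [Fintype S] (X : Observable S) : Matrix S S ℂ :=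
  ∑ x, (X.eigenvalue x : ℂ) • ketbra (X.eigenstate x)

/-- All differences of eigenvalues are integer multiples of `s`. -/
def Observable.HasSpacing {S : Type*} [Fintype S] (X : Observable S) (s : ℝ) : Prop :=
  ∀ x x' : S, ∃ n : ℤ, X.eigenvalue x - X.eigenvalue x' = n * s

/-- `c = max_{x,z} |⟨ψ^x|φ^z⟩|²`. -/
def overlap {S : Type*} [Fintype S] (X Z : Observable S) : ℝ :=
  ⨆ p : S × S, ‖inner ℂ (X.eigenstate p.1) (Z.eigenstate p.2)‖ ^ 2

section MSD

variable {S S' M : Type*} [Fintype S] [Fintype S'] [Fintype M] [DecidableEq M]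

/-- `p(m,x) = (1/d) Tr[𝓘^m(|ψ^x⟩⟨ψ^x|)]`. -/
def noiseProb (𝓘 : Instrument S S' M) (X : Observable S) (m : M) (x : S) : ℝ :=
  (1 / (Fintype.card S : ℝ)) * (𝓘.op m (ketbra (X.eigenstate x))).trace.re

/-- The mean-square-deviation noise `∑_{m,x} p(m,x) (f(m) - ξ_x)²`. -/
def noiseMSD (𝓘 : Instrument S S' M) (X : Observable S) (f : M → ℝ) : ℝ :=
  ∑ m, ∑ x, noiseProb 𝓘 X m x * (f m - X.eigenvalue x) ^ 2

/-- `p(ẑ,z) = (1/d) ⟨φ^ẑ| (𝓔 ∘ 𝓘)(|φ^z⟩⟨φ^z|) |φ^ẑ⟩`. -/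
def disturbanceProb (𝓘 : Instrument S S' M) (𝓔 : Channel (S' × M) S) (Z : Observable S)
    (z' z : S) : ℝ :=
  (1 / (Fintype.card S : ℝ)) *
    (star (Z.eigenstate z').ofLp ⬝ᵥ
      (𝓔.map (𝓘.channel (ketbra (Z.eigenstate z))) *ᵥ (Z.eigenstate z').ofLp)).re

/-- The mean-square-deviation disturbance `∑_{ẑ,z} p(ẑ,z) (ζ_ẑ - ζ_z)²`. -/
def disturbanceMSD (𝓘 : Instrument S S' M) (𝓔 : Channel (S' × M) S) (Z : Observable S) : ℝ :=
  ∑ z', ∑ z, disturbanceProb 𝓘 𝓔 Z z' z * (Z.eigenvalue z' - Z.eigenvalue z) ^ 2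

end MSD

/-- The maximally mixed state. -/
def maximallyMixed (S : Type*) [Fintype S] [DecidableEq S] : Matrix S S ℂ :=
  ((Fintype.card S : ℂ)⁻¹) • (1 : Matrix S S ℂ)

/-- The partial trace over the second factor. -/
def partialTrace {S K : Type*} [Fintype K] (T : Matrix (S × K) (S × K) ℂ) : Matrix S S ℂ :=
  Matrix.of fun i j => ∑ k, T (i, k) (j, k)

/-- An (indirect) measuring process on the system `S`: a probe `K` prepared in the state `probe`,
a unitary interaction `U` of system and probe, and a projective measurement `meter` on the
probe with outcomes in `M`. -/
structure MeasuringProcess (S M K : Type*) [Fintype S] [DecidableEq S] [Fintype M]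
    [DecidableEq M] [Fintype K] [DecidableEq K] where
  probe : Matrix K K ℂ
  probe_posSemidef : probe.PosSemidef
  probe_trace : probe.trace = 1
  U : Matrix (S × K) (S × K) ℂ
  U_unitary : U ∈ Matrix.unitaryGroup (S × K) ℂ
  meter : M → Matrix K K ℂ
  meter_isHermitian : ∀ m, (meter m).IsHermitian
  meter_mul : ∀ m m', meter m * meter m' = if m = m' then meter m else 0
  meter_sum : ∑ m, meter m = 1

namespace MeasuringProcess

variable {S M K : Type*} [Fintype S] [DecidableEq S] [Fintype M] [DecidableEq M] [Fintype K]
  [DecidableEq K]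

/-- The (unnormalised) state of the system after outcome `m`:
`Tr_K[(1 ⊗ P_m) U (ρ ⊗ σ) U† (1 ⊗ P_m)]`. -/
def op (P : MeasuringProcess S M K) (m : M) (ρ : Matrix S S ℂ) : Matrix S S ℂ :=
  partialTrace (((1 : Matrix S S ℂ) ⊗ₖ P.meter m) * P.U * (ρ ⊗ₖ P.probe) * P.Uᴴ *
    ((1 : Matrix S S ℂ) ⊗ₖ P.meter m))

/-- The meter observable `∑ m, f(m) P_m` with readings `f(m)`. -/
def meterObservable (P : MeasuringProcess S M K) (f : M → ℝ) : Matrix K K ℂ :=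
  ∑ m, (f m : ℂ) • P.meter m

/-- The noise operator `U† (1 ⊗ f(M)) U - X ⊗ 1`. -/
def noiseOperator (P : MeasuringProcess S M K) (f : M → ℝ) (X : Matrix S S ℂ) :
    Matrix (S × K) (S × K) ℂ :=
  P.Uᴴ * ((1 : Matrix S S ℂ) ⊗ₖ P.meterObservable f) * P.U - X ⊗ₖ (1 : Matrix K K ℂ)

/-- The disturbance operator `U† (Z ⊗ 1) U - Z ⊗ 1`. -/
def disturbanceOperator (P : MeasuringProcess S M K) (Z : Matrix S S ℂ) :
    Matrix (S × K) (S × K) ℂ :=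
  P.Uᴴ * (Z ⊗ₖ (1 : Matrix K K ℂ)) * P.U - Z ⊗ₖ (1 : Matrix K K ℂ)

/-- Ozawa's noise `ε(X,ρ)`, the root mean square of the noise operator in the initial state
`ρ ⊗ σ`. -/
def ozawaNoise (P : MeasuringProcess S M K) (f : M → ℝ) (X ρ : Matrix S S ℂ) : ℝ :=
  Real.sqrt ((P.noiseOperator f X ^ 2 * (ρ ⊗ₖ P.probe)).trace.re)

/-- Ozawa's disturbance `η(Z,ρ)`, the root mean square of the disturbance operator in the initial
state `ρ ⊗ σ`. -/
def ozawaDisturbance (P : MeasuringProcess S M K) (Z ρ : Matrix S S ℂ) : ℝ :=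
  Real.sqrt ((P.disturbanceOperator Z ^ 2 * (ρ ⊗ₖ P.probe)).trace.re)

/-- The measuring process has the outcome statistics of the instrument `𝓘`, in every input
state. -/
def HasStatisticsOf {S' : Type*} [Fintype S'] (P : MeasuringProcess S M K)
    (𝓘 : Instrument S S' M) : Prop :=
  ∀ m ρ, (P.op m ρ).trace = (𝓘.op m ρ).trace

/-- The measuring process transforms the system, disregarding its own outcome, as the instrument
`𝓘` followed by the correction `𝓔` does. -/
def HasChannelOf {S' : Type*} [Fintype S'] (P : MeasuringProcess S M K)
    (𝓘 : Instrument S S' M) (𝓔 : Channel (S' × M) S) : Prop :=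
  ∀ ρ, ∑ m, P.op m ρ = 𝓔.map (𝓘.channel ρ)

/-- The measuring process realises the instrument `𝓘` followed by the correction `𝓔`, outcome by
outcome. -/
def Realises {S' : Type*} [Fintype S'] (P : MeasuringProcess S M K)
    (𝓘 : Instrument S S' M) (𝓔 : Channel (S' × M) S) : Prop :=
  ∀ m ρ, P.op m ρ = 𝓔.map (𝓘.flagged m ρ)

end MeasuringProcess

/-- The Pauli matrix `σ_X`. -/
def pauliX : Matrix (Fin 2) (Fin 2) ℂ := !![0, 1; 1, 0]

/-- The Pauli matrix `σ_Z`. -/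
def pauliZ : Matrix (Fin 2) (Fin 2) ℂ := !![1, 0; 0, -1]

end NoiseDisturbance

end

open NoiseDisturbance

/-!
Every completely positive map has Kraus operators (`IsCompletelyPositive.exists_kraus`), so the
instrument followed by the correction is a family `A_j` of operators on `S` with `∑ A_j† A_j = 1`,
each labelled by an outcome `m` (`exists_krausFamily`). A final measurement of `Z` with result `ẑ`
refines the whole procedure into the rank-one effects of the vectors `v_{j,ẑ} = A_j† φ^ẑ`, whose
squared lengths add up to `d`. Both mean-square deviations are sums over this one family: with
`m` the label of `j`, the noise is `(1/d) ∑ |⟨ψ^x|v_{j,ẑ}⟩|² (f(m) - ξ_x)²` and the disturbance is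
`(1/d) ∑ |⟨φ^z|v_{j,ẑ}⟩|² (ζ_ẑ - ζ_z)²` (`KrausFamily.noiseMSD_eq`,
`KrausFamily.disturbanceMSD_eq`).

*Tradeoff.* For one unit vector, the entropies of the two distributions `|⟨ψ^x|v⟩|²` and
`|⟨φ^z|v⟩|²` add up to at least `-log c` by the Maassen–Uffink relation
(`neg_log_le_sum_negMulLog`), here obtained by differentiating the three-lines theorem at the
boundary point where equality holds. A random variable with values in a lattice of spacing `s` and
mean-square deviation `V` has entropy at most `½ log (2πe (V + s²/12) / s²)`
(`sum_negMulLog_le`): smearing it uniformly over bins of width `s` adds `s²/12` to the variance,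
and Gaussians maximise differential entropy. This gives the inequality for one vector, with
arbitrary estimates, and Cauchy–Schwarz averages it over the family (`sq_le_mul_of_sum_norm_sq`).

*Ozawa's quantities.* In the maximally mixed state, which commutes with every observable, the
square of `U† G U - X ⊗ 1` has an expectation that is linear in `G²` and `G` evaluated after the
interaction (`MeasuringProcess.trace_sq_sub_mul_maximallyMixed`). For `G` a meter observable it
depends only on the outcome statistics, for `G` an operator on `S` only on the total channel. A realising measuring
process is the unitary dilation of the Kraus family (`MeasuringProcess.exists_realises`).

*Qubit.* Zero noise forces every `v_{j,ẑ}` to be proportional to an eigenvector of `σ_X`; such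
vectors are unbiased between the eigenvectors of `σ_Z`, so `ẑ ≠ z` has probability `1/2`, at a cost
of `4`.
-/

namespace NoiseDisturbance

/-! ### The Maassen–Uffink relation -/

/-- Three-lines theorem in differentiated form: if an exponential sum `∑ C_i e^{w L_i}` takes its
maximum modulus `1` on the imaginary axis at `w = 0` and is at most `B` in modulus on `Re w = 1`,
then its logarithmic derivative at `0` is at most `log B`. -/
theorem sum_re_mul_le_log_of_three_lines {ι : Type*} [Fintype ι] (C : ι → ℂ) (L : ι → ℝ) {B : ℝ}
    (hB : 0 < B) (h0 : ∑ i, C i = 1)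
    (hl : ∀ w : ℂ, w.re = 0 → ‖∑ i, C i * Complex.exp (w * L i)‖ ≤ 1)
    (hr : ∀ w : ℂ, w.re = 1 → ‖∑ i, C i * Complex.exp (w * L i)‖ ≤ B) :
    ∑ i, (C i).re * L i ≤ Real.log B := by
  set F : ℂ → ℂ := fun w => ∑ i, C i * Complex.exp (w * L i) with hF
  have hdiff : Differentiable ℂ F := by fun_prop
  have hbdd : BddAbove ((norm ∘ F) '' Complex.HadamardThreeLines.verticalClosedStrip 0 1) := by
    refine ⟨∑ i, ‖C i‖ * Real.exp |L i|, ?_⟩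
    rintro _ ⟨w, hw, rfl⟩
    refine (norm_sum_le _ _).trans (Finset.sum_le_sum fun i _ => ?_)
    rw [norm_mul, Complex.norm_exp]
    refine mul_le_mul_of_nonneg_left (Real.exp_le_exp.2 ?_) (norm_nonneg _)
    have hw' : 0 ≤ w.re ∧ w.re ≤ 1 := hw
    have : (w * (L i : ℂ)).re = w.re * L i := by simp
    rw [this]
    calc w.re * L i ≤ w.re * |L i| := mul_le_mul_of_nonneg_left (le_abs_self _) hw'.1
      _ ≤ 1 * |L i| := mul_le_mul_of_nonneg_right hw'.2 (abs_nonneg _)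
      _ = |L i| := one_mul _
  have hinterp : ∀ t : ℝ, 0 ≤ t → t ≤ 1 → ‖F t‖ ≤ B ^ t := by
    intro t ht0 ht1
    have := Complex.HadamardThreeLines.norm_le_interp_of_mem_verticalClosedStrip₀₁' F (z := (t : ℂ))
      (a := 1) (b := B) ⟨by simpa using ht0, by simpa using ht1⟩ hdiff.diffContOnCl hbdd
      (fun w hw => hl w hw) (fun w hw => hr w hw)
    simpa using this
  set g : ℝ → ℝ := fun t => (∑ i, (C i).re * Real.exp (t * L i)) - B ^ t with hg
  have hg0 : g 0 = 0 := by
    have : ∑ i, (C i).re = 1 := by rw [← Complex.re_sum, h0, Complex.one_re]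
    simp [hg, this]
  have hg1 : ∀ t : ℝ, 0 ≤ t → t ≤ 1 → g t ≤ 0 := by
    intro t ht0 ht1
    have hre : (F t).re = ∑ i, (C i).re * Real.exp (t * L i) := by
      simp only [hF, Complex.re_sum]
      refine Finset.sum_congr rfl fun i _ => ?_
      rw [← Complex.ofReal_mul, ← Complex.ofReal_exp, Complex.re_mul_ofReal]
    have := (Complex.re_le_norm (F t)).trans (hinterp t ht0 ht1)
    simp only [hg]; linarith
  have hder : HasDerivAt g ((∑ i, (C i).re * L i) - Real.log B) 0 := by
    have h1 : HasDerivAt (fun t : ℝ => ∑ i, (C i).re * Real.exp (t * L i))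
        (∑ i, (C i).re * (Real.exp (0 * L i) * (1 * L i))) 0 :=
      HasDerivAt.fun_sum fun i _ =>
        (((hasDerivAt_id (0 : ℝ)).mul_const (L i)).exp).const_mul _
    have h2 := (Real.hasStrictDerivAt_const_rpow hB 0).hasDerivAt
    have h3 := h1.fun_sub h2
    simp only [zero_mul, Real.exp_zero, one_mul, Real.rpow_zero] at h3
    exact h3
  have hlim := hder.tendsto_slope_zero_right
  have : (∑ i, (C i).re * L i) - Real.log B ≤ 0 := by
    refine le_of_tendsto hlim ?_
    filter_upwards [Ioc_mem_nhdsGT (zero_lt_one' ℝ)] with t ht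
    rw [zero_add, hg0, sub_zero, smul_eq_mul]
    exact mul_nonpos_of_nonneg_of_nonpos (inv_nonneg.2 ht.1.le) (hg1 t ht.1.le ht.2)
  linarith

/-- Cauchy–Schwarz for the transition matrix of two orthonormal bases. -/
theorem norm_sum_mul_inner_mul_le {S E : Type*} [Fintype S] [NormedAddCommGroup E]
    [InnerProductSpace ℂ E] (ψ φ : OrthonormalBasis S ℂ E) (a b : S → ℂ) :
    ‖∑ p : S × S, b p.2 * inner ℂ (φ p.2) (ψ p.1) * a p.1‖ ≤
      √(∑ z, ‖b z‖ ^ 2) * √(∑ x, ‖a x‖ ^ 2) := by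
  classical
  have hn : ∀ (χ : OrthonormalBasis S ℂ E) (a : S → ℂ),
      ‖∑ x, a x • χ x‖ = √(∑ x, ‖a x‖ ^ 2) := by
    intro χ a
    rw [← Real.sqrt_sq (norm_nonneg (∑ x, a x • χ x)), ← OrthonormalBasis.sum_sq_norm_inner_right χ]
    simp [χ.inner_eq_ite, inner_sum, inner_smul_right]
  have hs : ∑ p : S × S, b p.2 * inner ℂ (φ p.2) (ψ p.1) * a p.1 =
      inner ℂ (∑ z, (starRingEnd ℂ (b z)) • φ z) (∑ x, a x • ψ x) := by
    rw [sum_inner, Fintype.sum_prod_type_right]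
    refine Finset.sum_congr rfl fun z _ => ?_
    rw [inner_sum]
    refine Finset.sum_congr rfl fun x _ => ?_
    rw [inner_smul_left, inner_smul_right, Complex.conj_conj]
    ring
  rw [hs]
  refine (norm_inner_le_norm _ _).trans_eq ?_
  rw [hn, hn]
  simp

/-- The **Maassen–Uffink** entropic uncertainty relation. -/
theorem neg_log_le_sum_negMulLog {S E : Type*} [Fintype S] [NormedAddCommGroup E]
    [InnerProductSpace ℂ E] (ψ φ : OrthonormalBasis S ℂ E) {c : ℝ} (hc : 0 < c)
    (h : ∀ x z, ‖inner ℂ (ψ x) (φ z)‖ ^ 2 ≤ c) {v : E} (hv : ‖v‖ = 1) :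
    -Real.log c ≤ ∑ x, Real.negMulLog (‖inner ℂ (ψ x) v‖ ^ 2) +
      ∑ z, Real.negMulLog (‖inner ℂ (φ z) v‖ ^ 2) := by
  set a : S → ℂ := fun x => inner ℂ (ψ x) v with ha
  set b : S → ℂ := fun z => inner ℂ (φ z) v with hb
  have ha1 : ∑ x, ‖a x‖ ^ 2 = 1 := by rw [OrthonormalBasis.sum_sq_norm_inner_right ψ, hv, one_pow]
  have hb1 : ∑ x, ‖b x‖ ^ 2 = 1 := by rw [OrthonormalBasis.sum_sq_norm_inner_right φ, hv, one_pow]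
  set C : S × S → ℂ := fun p => starRingEnd ℂ (b p.2) * inner ℂ (φ p.2) (ψ p.1) * a p.1 with hC
  set L : S × S → ℝ := fun p => Real.log ‖b p.2‖ + Real.log ‖a p.1‖ with hL
  have hrow : ∀ z, ∑ x, C (x, z) = ((‖b z‖ ^ 2 : ℝ) : ℂ) := by
    intro z
    have : b z = ∑ x, inner ℂ (φ z) (ψ x) * a x := by
      simp only [hb, ha]
      rw [OrthonormalBasis.sum_inner_mul_inner]
    simp only [hC, mul_assoc]
    rw [← Finset.mul_sum, ← this, ← Complex.normSq_eq_conj_mul_self, Complex.normSq_eq_norm_sq]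
  have hcol : ∀ x, ∑ z, C (x, z) = ((‖a x‖ ^ 2 : ℝ) : ℂ) := by
    intro x
    have : starRingEnd ℂ (a x) = ∑ z, starRingEnd ℂ (b z) * inner ℂ (φ z) (ψ x) := by
      simp only [hb, ha, inner_conj_symm]
      rw [OrthonormalBasis.sum_inner_mul_inner]
    simp only [hC]
    rw [← Finset.sum_mul, ← this, ← Complex.normSq_eq_conj_mul_self, Complex.normSq_eq_norm_sq]
  have hfac : ∀ w : ℂ, ∑ p, C p * Complex.exp (w * L p) =
      ∑ p : S × S, (starRingEnd ℂ (b p.2) * Complex.exp (w * Real.log ‖b p.2‖)) *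
        inner ℂ (φ p.2) (ψ p.1) * (a p.1 * Complex.exp (w * Real.log ‖a p.1‖)) := by
    intro w
    refine Finset.sum_congr rfl fun p _ => ?_
    simp only [hC, hL]
    rw [Complex.ofReal_add, mul_add, Complex.exp_add]
    ring
  have hexp0 : ∀ w : ℂ, w.re = 0 → ∀ r : ℝ, ‖Complex.exp (w * r)‖ = 1 := by
    intro w hw r
    rw [Complex.norm_exp]; simp [hw]
  -- for `u = 0` both sides vanish, whatever the value of `log 0`
  have hexp1 : ∀ w : ℂ, w.re = 1 → ∀ u : ℂ, ‖u‖ * ‖Complex.exp (w * Real.log ‖u‖)‖ = ‖u‖ ^ 2 := by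
    intro w hw u
    rcases eq_or_ne u 0 with rfl | hu
    · simp
    rw [Complex.norm_exp, Complex.re_mul_ofReal, hw, one_mul, Real.exp_log (norm_pos_iff.2 hu), sq]
  have hmain := sum_re_mul_le_log_of_three_lines C L (B := √c) (Real.sqrt_pos.2 hc) ?_ ?_ ?_
  · have hsplit : ∑ p, (C p).re * L p =
        ∑ z, ‖b z‖ ^ 2 * Real.log ‖b z‖ + ∑ x, ‖a x‖ ^ 2 * Real.log ‖a x‖ := by
      simp only [hL, mul_add, Finset.sum_add_distrib]
      congr 1
      · rw [Fintype.sum_prod_type_right]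
        refine Finset.sum_congr rfl fun z _ => ?_
        dsimp only
        rw [← Finset.sum_mul, ← Complex.re_sum, hrow, Complex.ofReal_re]
      · rw [Fintype.sum_prod_type]
        refine Finset.sum_congr rfl fun x _ => ?_
        dsimp only
        rw [← Finset.sum_mul, ← Complex.re_sum, hcol, Complex.ofReal_re]
    have hent : ∀ u : S → ℂ, ∑ x, Real.negMulLog (‖u x‖ ^ 2) =
        -2 * ∑ x, ‖u x‖ ^ 2 * Real.log ‖u x‖ := by
      intro u
      rw [Finset.mul_sum]
      refine Finset.sum_congr rfl fun x _ => ?_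
      rw [Real.negMulLog, Real.log_pow]; push_cast; ring
    rw [hsplit, Real.log_sqrt hc.le] at hmain
    rw [hent, hent]
    linarith
  · rw [Fintype.sum_prod_type]
    simp only [hcol]
    rw [← Complex.ofReal_sum, ha1, Complex.ofReal_one]
  · intro w hw
    rw [hfac]
    refine (norm_sum_mul_inner_mul_le ψ φ
      (fun x => a x * Complex.exp (w * Real.log ‖a x‖))
      (fun z => starRingEnd ℂ (b z) * Complex.exp (w * Real.log ‖b z‖))).trans_eq ?_
    simp [hexp0 w hw, ha1, hb1]
  · intro w hw
    rw [hfac]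
    refine (norm_sum_le _ _).trans ?_
    have hterm : ∀ p : S × S, ‖(starRingEnd ℂ (b p.2) * Complex.exp (w * Real.log ‖b p.2‖)) *
        inner ℂ (φ p.2) (ψ p.1) * (a p.1 * Complex.exp (w * Real.log ‖a p.1‖))‖ ≤
        ‖b p.2‖ ^ 2 * √c * ‖a p.1‖ ^ 2 := by
      intro p
      have h1 : ‖starRingEnd ℂ (b p.2) * Complex.exp (w * Real.log ‖b p.2‖)‖ = ‖b p.2‖ ^ 2 := by
        rw [norm_mul, RCLike.norm_conj]
        exact hexp1 w hw (b p.2)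
      have h2 : ‖a p.1 * Complex.exp (w * Real.log ‖a p.1‖)‖ = ‖a p.1‖ ^ 2 := by
        rw [norm_mul]
        exact hexp1 w hw (a p.1)
      have h3 : ‖inner ℂ (φ p.2) (ψ p.1)‖ ≤ √c := by
        rw [norm_inner_symm]
        exact Real.le_sqrt_of_sq_le (h p.1 p.2)
      rw [norm_mul, norm_mul, h1, h2]
      exact mul_le_mul_of_nonneg_right (mul_le_mul_of_nonneg_left h3 (sq_nonneg _)) (sq_nonneg _)
    calc _ ≤ ∑ p : S × S, ‖b p.2‖ ^ 2 * √c * ‖a p.1‖ ^ 2 := Finset.sum_le_sum fun p _ => hterm p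
      _ = √c := by
          rw [Fintype.sum_prod_type]
          simp only [← Finset.sum_mul, ← Finset.mul_sum, ha1, hb1, one_mul, mul_one]

/-! ### Entropy and mean-square deviation of a lattice-valued random variable -/

/-- Jensen's inequality for the Gaussian on a bin of width `s`; the mean of `(t - f)²` over the bin
centred at `a` is `(a - f)² + s² / 12`. -/
theorem mul_exp_le_integral_gaussian_bin (a f : ℝ) {s v : ℝ} (hs : 0 < s) (hv : 0 < v) :
    s * Real.exp (-((a - f) ^ 2 + s ^ 2 / 12) / (2 * v)) ≤
      ∫ t in Set.Ioc (a - s / 2) (a + s / 2), Real.exp (-(1 / (2 * v)) * (t - f) ^ 2) := by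
  set A := -((a - f) ^ 2 + s ^ 2 / 12) / (2 * v) with hA
  have hle : a - s / 2 ≤ a + s / 2 := by linarith
  rw [← intervalIntegral.integral_of_le hle]
  have hint : ∫ t in (a - s / 2)..(a + s / 2), (t - f) ^ 2 = s * ((a - f) ^ 2 + s ^ 2 / 12) := by
    rw [intervalIntegral.integral_comp_sub_right (fun t => t ^ 2) f, integral_pow]
    push_cast
    ring
  have htan : ∫ t in (a - s / 2)..(a + s / 2),
      (Real.exp A * (1 - A) + (-Real.exp A / (2 * v)) * (t - f) ^ 2) = s * Real.exp A := by
    rw [intervalIntegral.integral_add (Continuous.intervalIntegrable (by fun_prop) _ _)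
      (Continuous.intervalIntegrable (by fun_prop) _ _), intervalIntegral.integral_const,
      intervalIntegral.integral_const_mul, hint, smul_eq_mul, hA]
    field_simp
    ring
  rw [← htan]
  refine intervalIntegral.integral_mono_on hle (Continuous.intervalIntegrable (by fun_prop) _ _)
    (Continuous.intervalIntegrable (by fun_prop) _ _) fun t _ => ?_
  -- the tangent line of `exp` at `A`
  have h := Real.add_one_le_exp (-(1 / (2 * v)) * (t - f) ^ 2 - A)
  calc _ = Real.exp A * (-(1 / (2 * v)) * (t - f) ^ 2 - A + 1) := by ring
    _ ≤ Real.exp A * Real.exp (-(1 / (2 * v)) * (t - f) ^ 2 - A) :=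
        mul_le_mul_of_nonneg_left h (Real.exp_pos _).le
    _ = _ := by rw [← Real.exp_add]; congr 1; ring

/-- Disjoint bins carry total Gaussian mass at most one. -/
theorem sum_mul_exp_le_sqrt {S : Type*} [Fintype S] (ξ : S → ℝ) (f : ℝ) {s v : ℝ} (hs : 0 < s)
    (hv : 0 < v) (hsep : ∀ x x', x ≠ x' → s ≤ |ξ x - ξ x'|) :
    ∑ x, s * Real.exp (-((ξ x - f) ^ 2 + s ^ 2 / 12) / (2 * v)) ≤ √(2 * Real.pi * v) := by
  have hi : MeasureTheory.Integrable (fun t : ℝ => Real.exp (-(1 / (2 * v)) * (t - f) ^ 2)) :=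
    (integrable_exp_neg_mul_sq (b := 1 / (2 * v)) (by positivity)).comp_sub_right f
  have hdisj : Pairwise (Function.onFun Disjoint
      fun x => Set.Ioc (ξ x - s / 2) (ξ x + s / 2)) := by
    intro x x' hxx
    rw [Function.onFun, Set.disjoint_left]
    rintro t ⟨h1, h2⟩ ⟨h3, h4⟩
    have h5 : |ξ x - ξ x'| < s := by rw [abs_lt]; constructor <;> linarith
    exact absurd (hsep x x' hxx) (not_le.2 h5)
  calc _ ≤ ∑ x, ∫ t in Set.Ioc (ξ x - s / 2) (ξ x + s / 2),
          Real.exp (-(1 / (2 * v)) * (t - f) ^ 2) :=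
        Finset.sum_le_sum fun x _ => mul_exp_le_integral_gaussian_bin (ξ x) f hs hv
    _ = ∫ t in ⋃ x, Set.Ioc (ξ x - s / 2) (ξ x + s / 2),
          Real.exp (-(1 / (2 * v)) * (t - f) ^ 2) :=
        (MeasureTheory.integral_iUnion_fintype (fun _ => measurableSet_Ioc) hdisj
          fun _ => hi.integrableOn).symm
    _ ≤ ∫ t, Real.exp (-(1 / (2 * v)) * (t - f) ^ 2) :=
        MeasureTheory.setIntegral_le_integral hi (Filter.Eventually.of_forall fun t =>
          (Real.exp_pos _).le)
    _ = √(2 * Real.pi * v) := by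
        rw [MeasureTheory.integral_sub_right_eq_self (fun t => Real.exp (-(1 / (2 * v)) * t ^ 2)) f,
          integral_gaussian]
        congr 1
        field_simp

/-- Among random variables on a set of points at mutual distance at least `s`, the Shannon entropy
is bounded by the differential entropy of a Gaussian of variance `V + s² / 12`, in units of `s`.
The reference weights in Gibbs' inequality are the geometric means of the Gaussian density over bins
of width `s`. -/
theorem sum_negMulLog_le {S : Type*} [Fintype S] (ξ p : S → ℝ) (f : ℝ) {s : ℝ} (hs : 0 < s)
    (hsep : ∀ x x', x ≠ x' → s ≤ |ξ x - ξ x'|) (hp : ∀ x, 0 ≤ p x) (hp1 : ∑ x, p x = 1) :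
    ∑ x, Real.negMulLog (p x) ≤ 1 / 2 *
      Real.log (2 * Real.pi * Real.exp 1 * (∑ x, p x * (f - ξ x) ^ 2 + s ^ 2 / 12) / s ^ 2) := by
  set v := ∑ x, p x * (f - ξ x) ^ 2 + s ^ 2 / 12 with hvdef
  have hv : 0 < v := by
    have : 0 ≤ ∑ x, p x * (f - ξ x) ^ 2 :=
      Finset.sum_nonneg fun x _ => mul_nonneg (hp x) (sq_nonneg _)
    positivity
  have hπ := Real.pi_pos
  set r := √(2 * Real.pi * v) with hr
  have hr0 : 0 < r := Real.sqrt_pos.2 (by positivity)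
  set e : S → ℝ := fun x => -((ξ x - f) ^ 2 + s ^ 2 / 12) / (2 * v) with he
  set q : S → ℝ := fun x => s * Real.exp (e x) / r with hq
  have hq0 : ∀ x, 0 < q x := fun x => by simp only [hq]; positivity
  have hq1 : ∑ x, q x ≤ 1 := by
    simp only [hq]
    rw [← Finset.sum_div, div_le_one hr0]
    exact sum_mul_exp_le_sqrt ξ f hs hv hsep
  have hlogq : ∀ x, Real.log (q x) = Real.log s + e x - Real.log r := by
    intro x
    simp only [hq]
    rw [Real.log_div (by positivity) hr0.ne', Real.log_mul hs.ne' (Real.exp_pos _).ne', Real.log_exp]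
  have hgibbs : ∀ x, Real.negMulLog (p x) ≤ -(p x * Real.log (q x)) + (q x - p x) := by
    intro x
    rcases (hp x).eq_or_lt with h0 | h0
    · rw [← h0]; simpa using (hq0 x).le
    · have h1 := Real.log_le_sub_one_of_pos (div_pos (hq0 x) h0)
      rw [Real.log_div (hq0 x).ne' h0.ne'] at h1
      have h2 := mul_le_mul_of_nonneg_left h1 h0.le
      have h3 : p x * (q x / p x - 1) = q x - p x := by field_simp
      rw [h3] at h2
      rw [Real.negMulLog]
      linarith
  have hpe : ∑ x, p x * e x = -(1 / 2) := by
    have h1 : ∀ x, p x * e x = (p x * (f - ξ x) ^ 2 + p x * (s ^ 2 / 12)) * (-1 / (2 * v)) := by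
      intro x; simp only [he]; ring
    simp only [h1]
    rw [← Finset.sum_mul, Finset.sum_add_distrib, ← Finset.sum_mul, hp1, one_mul, ← hvdef]
    field_simp
  have hplog : ∑ x, p x * Real.log (q x) = Real.log s - 1 / 2 - Real.log r := by
    simp only [hlogq, mul_sub, mul_add, Finset.sum_sub_distrib, Finset.sum_add_distrib, hpe,
      ← Finset.sum_mul, hp1]
    ring
  have hsum := Finset.sum_le_sum fun x (_ : x ∈ Finset.univ) => hgibbs x
  rw [Finset.sum_add_distrib, Finset.sum_neg_distrib, Finset.sum_sub_distrib, hplog, hp1] at hsum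
  have hlogr : Real.log r = 1 / 2 * Real.log (2 * Real.pi * v) := by
    rw [hr, Real.log_sqrt (by positivity)]; ring
  have hfin : Real.log (2 * Real.pi * Real.exp 1 * v / s ^ 2) =
      Real.log (2 * Real.pi * v) + 1 - 2 * Real.log s := by
    rw [show 2 * Real.pi * Real.exp 1 * v = (2 * Real.pi * v) * Real.exp 1 by ring,
      Real.log_div (by positivity) (by positivity), Real.log_mul (by positivity) (by positivity),
      Real.log_exp, Real.log_pow]
    push_cast; ring
  rw [hfin]
  linarith

/-! ### The uncertainty product -/

/-- Distinct eigenvalues of an observable with spacing `s` are at least `|s|` apart. -/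
theorem Observable.HasSpacing.abs_le {S : Type*} [Fintype S] {X : Observable S} {s : ℝ}
    (h : X.HasSpacing s) {x x' : S} (hx : x ≠ x') :
    |s| ≤ |X.eigenvalue x - X.eigenvalue x'| := by
  obtain ⟨n, hn⟩ := h x x'
  have hn0 : n ≠ 0 := by
    rintro rfl
    rw [Int.cast_zero, zero_mul, sub_eq_zero] at hn
    exact hx (X.nondegenerate hn)
  rw [hn, abs_mul]
  have : (1 : ℝ) ≤ |(n : ℝ)| := by exact_mod_cast Int.one_le_abs hn0
  exact le_mul_of_one_le_left (abs_nonneg _) this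

theorem overlap_pos {S : Type*} [Fintype S] [Nonempty S] (X Z : Observable S) :
    0 < overlap X Z := by
  obtain ⟨x⟩ := ‹Nonempty S›
  have h1 := Z.eigenstate.sum_sq_norm_inner_right (X.eigenstate x)
  rw [X.eigenstate.norm_eq_one, one_pow] at h1
  obtain ⟨z, -, hz⟩ : ∃ z ∈ Finset.univ, ‖inner ℂ (Z.eigenstate z) (X.eigenstate x)‖ ^ 2 ≠ 0 :=
    Finset.exists_ne_zero_of_sum_ne_zero (h1.trans_ne one_ne_zero)
  rw [norm_inner_symm] at hz
  exact (lt_of_le_of_ne (sq_nonneg _) hz.symm).trans_le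
    (le_ciSup (f := fun p : S × S => ‖inner ℂ (X.eigenstate p.1) (Z.eigenstate p.2)‖ ^ 2)
      (Set.finite_range _).bddAbove (x, z))

/-- The tradeoff for one unit vector, with arbitrary estimates `f` and `g` of the two observables. -/
theorem sq_le_mul_of_norm_eq_one {S : Type*} [Fintype S] [Nonempty S] (X Z : Observable S)
    {sX sZ : ℝ} (hX : X.HasSpacing sX) (hZ : Z.HasSpacing sZ) (f g : ℝ) {v : EuclideanSpace ℂ S}
    (hv : ‖v‖ = 1) :
    (sX * sZ / (2 * Real.pi * Real.exp 1 * overlap X Z)) ^ 2 ≤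
      (∑ x, ‖inner ℂ (X.eigenstate x) v‖ ^ 2 * (f - X.eigenvalue x) ^ 2 + sX ^ 2 / 12) *
      (∑ z, ‖inner ℂ (Z.eigenstate z) v‖ ^ 2 * (g - Z.eigenvalue z) ^ 2 + sZ ^ 2 / 12) := by
  set A := ∑ x, ‖inner ℂ (X.eigenstate x) v‖ ^ 2 * (f - X.eigenvalue x) ^ 2 + sX ^ 2 / 12 with hA
  set B := ∑ z, ‖inner ℂ (Z.eigenstate z) v‖ ^ 2 * (g - Z.eigenvalue z) ^ 2 + sZ ^ 2 / 12 with hB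
  have hA0 : sX ^ 2 / 12 ≤ A :=
    le_add_of_nonneg_left (Finset.sum_nonneg fun x _ => mul_nonneg (sq_nonneg _) (sq_nonneg _))
  have hB0 : sZ ^ 2 / 12 ≤ B :=
    le_add_of_nonneg_left (Finset.sum_nonneg fun x _ => mul_nonneg (sq_nonneg _) (sq_nonneg _))
  rcases eq_or_ne (sX * sZ) 0 with h0 | h0
  · rw [h0, zero_div, zero_pow two_ne_zero]
    exact mul_nonneg (le_trans (by positivity) hA0) (le_trans (by positivity) hB0)
  have hsX : 0 < |sX| := abs_pos.2 (left_ne_zero_of_mul h0)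
  have hsZ : 0 < |sZ| := abs_pos.2 (right_ne_zero_of_mul h0)
  have hsX2 : 0 < sX ^ 2 := by rw [← sq_abs]; positivity
  have hsZ2 : 0 < sZ ^ 2 := by rw [← sq_abs]; positivity
  have hApos : 0 < A := lt_of_lt_of_le (by positivity) hA0
  have hBpos : 0 < B := lt_of_lt_of_le (by positivity) hB0
  have hc := overlap_pos X Z
  have hMU := neg_log_le_sum_negMulLog X.eigenstate Z.eigenstate hc
    (fun x z => le_ciSup (f := fun p : S × S =>
      ‖inner ℂ (X.eigenstate p.1) (Z.eigenstate p.2)‖ ^ 2)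
      (Set.finite_range _).bddAbove (x, z)) hv
  have hEX := sum_negMulLog_le X.eigenvalue (fun x => ‖inner ℂ (X.eigenstate x) v‖ ^ 2) f hsX
    (fun x x' => hX.abs_le) (fun x => sq_nonneg _)
    (by rw [X.eigenstate.sum_sq_norm_inner_right, hv, one_pow])
  have hEZ := sum_negMulLog_le Z.eigenvalue (fun x => ‖inner ℂ (Z.eigenstate x) v‖ ^ 2) g hsZ
    (fun x x' => hZ.abs_le) (fun x => sq_nonneg _)
    (by rw [Z.eigenstate.sum_sq_norm_inner_right, hv, one_pow])
  rw [sq_abs, ← hA] at hEX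
  rw [sq_abs, ← hB] at hEZ
  set c := overlap X Z
  set K := 2 * Real.pi * Real.exp 1 with hK
  have hK0 : 0 < K := by positivity
  have hlog : Real.log ((c ^ 2)⁻¹) ≤ Real.log ((K * A / sX ^ 2) * (K * B / sZ ^ 2)) := by
    rw [Real.log_mul (by positivity) (by positivity), Real.log_inv, Real.log_pow]
    push_cast
    linarith
  rw [Real.log_le_log_iff (by positivity) (by positivity)] at hlog
  calc (sX * sZ / (K * c)) ^ 2 = (c ^ 2)⁻¹ * (sX ^ 2 * sZ ^ 2 / K ^ 2) := by
        field_simp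
    _ ≤ ((K * A / sX ^ 2) * (K * B / sZ ^ 2)) * (sX ^ 2 * sZ ^ 2 / K ^ 2) :=
        mul_le_mul_of_nonneg_right hlog (by positivity)
    _ = A * B := by
        have hx := left_ne_zero_of_mul h0
        have hz := right_ne_zero_of_mul h0
        field_simp

/-- The tradeoff for a finite family of vectors of total squared length `d`: the inequality for
one vector is homogeneous, and Cauchy–Schwarz averages it over the family. -/
theorem sq_le_mul_of_sum_norm_sq {S J : Type*} [Fintype S] [Nonempty S] [Fintype J]
    (X Z : Observable S) {sX sZ : ℝ} (hX : X.HasSpacing sX) (hZ : Z.HasSpacing sZ) (f g : J → ℝ)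
    (v : J → EuclideanSpace ℂ S) {d : ℝ} (hd : 0 < d) (hv : ∑ j, ‖v j‖ ^ 2 = d) :
    (sX * sZ / (2 * Real.pi * Real.exp 1 * overlap X Z)) ^ 2 ≤
      (1 / d * ∑ j, ∑ x, ‖inner ℂ (X.eigenstate x) (v j)‖ ^ 2 * (f j - X.eigenvalue x) ^ 2 +
        sX ^ 2 / 12) *
      (1 / d * ∑ j, ∑ z, ‖inner ℂ (Z.eigenstate z) (v j)‖ ^ 2 * (g j - Z.eigenvalue z) ^ 2 +
        sZ ^ 2 / 12) := by
  set K := sX * sZ / (2 * Real.pi * Real.exp 1 * overlap X Z)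
  set a : J → ℝ := fun j => ∑ x, ‖inner ℂ (X.eigenstate x) (v j)‖ ^ 2 * (f j - X.eigenvalue x) ^ 2
    + ‖v j‖ ^ 2 * (sX ^ 2 / 12) with ha
  set b : J → ℝ := fun j => ∑ z, ‖inner ℂ (Z.eigenstate z) (v j)‖ ^ 2 * (g j - Z.eigenvalue z) ^ 2
    + ‖v j‖ ^ 2 * (sZ ^ 2 / 12) with hb
  have hscale : ∀ (Y : Observable S) (u : EuclideanSpace ℂ S) (y : ℝ), u ≠ 0 →
      ∑ x, ‖inner ℂ (Y.eigenstate x) u‖ ^ 2 * (y - Y.eigenvalue x) ^ 2 = ‖u‖ ^ 2 *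
        ∑ x, ‖inner ℂ (Y.eigenstate x) ((‖u‖⁻¹ : ℂ) • u)‖ ^ 2 * (y - Y.eigenvalue x) ^ 2 := by
    intro Y u y hu
    rw [Finset.mul_sum]
    refine Finset.sum_congr rfl fun x _ => ?_
    have : ‖u‖ ≠ 0 := norm_ne_zero_iff.2 hu
    rw [inner_smul_right, norm_mul, norm_inv, Complex.norm_real, norm_norm]
    field_simp
  have hj : ∀ j, (K * ‖v j‖ ^ 2) ^ 2 ≤ a j * b j := by
    intro j
    rcases eq_or_ne (v j) 0 with h0 | h0
    · simp [ha, hb, h0]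
    · have h1 := sq_le_mul_of_norm_eq_one X Z hX hZ (f j) (g j)
        (v := (‖v j‖⁻¹ : ℂ) • v j) (norm_smul_inv_norm h0)
      simp only [ha, hb]
      rw [hscale X _ _ h0, hscale Z _ _ h0, ← mul_add, ← mul_add, mul_mul_mul_comm, mul_pow, ← sq,
        mul_comm]
      exact mul_le_mul_of_nonneg_left h1 (sq_nonneg _)
  have ha0 : ∀ j, 0 ≤ a j := fun j => by simp only [ha]; positivity
  have hb0 : ∀ j, 0 ≤ b j := fun j => by simp only [hb]; positivity
  have hcs := Finset.sum_sq_le_sum_mul_sum_of_sq_le_mul Finset.univ (fun j _ => ha0 j)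
    (fun j _ => hb0 j) (fun j _ => hj j)
  rw [← Finset.mul_sum, hv] at hcs
  simp only [ha, hb, Finset.sum_add_distrib, ← Finset.sum_mul, hv] at hcs
  have h2 := mul_le_mul_of_nonneg_left hcs (show 0 ≤ (1 / d) ^ 2 by positivity)
  calc K ^ 2 = (1 / d) ^ 2 * (K * d) ^ 2 := by field_simp
    _ ≤ _ := h2
    _ = _ := by field_simp

/-! ### Kraus operators -/

/-- A completely positive map has a Kraus representation; the Kraus operators are the rows of a
square root of its Choi matrix. -/
theorem IsCompletelyPositive.exists_kraus {A B : Type*} [Fintype A] [Fintype B]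
    {Φ : Matrix A A ℂ →ₗ[ℂ] Matrix B B ℂ} (hΦ : IsCompletelyPositive Φ) :
    ∃ K : B × Fin (Fintype.card A) → Matrix B A ℂ, ∀ ρ, Φ ρ = ∑ r, K r * ρ * (K r)ᴴ := by
  classical
  let e := Fintype.equivFin A
  let u : A × Fin (Fintype.card A) → ℂ := fun p => if e p.1 = p.2 then 1 else 0
  have hpos := hΦ _ _ (Matrix.posSemidef_vecMulVec_self_star u)
  obtain ⟨W, hW⟩ : ∃ W : Matrix (B × Fin (Fintype.card A)) (B × Fin (Fintype.card A)) ℂ,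
      ampliation Φ (Matrix.vecMulVec u (star u)) = Wᴴ * W := by
    open scoped MatrixOrder in
    exact CStarAlgebra.nonneg_iff_eq_star_mul_self.1 (Matrix.nonneg_iff_posSemidef.2 hpos)
  have hchoi : ∀ i j b b', Φ (Matrix.single i j 1) b b' =
      ∑ r, star (W r (b, e i)) * W r (b', e j) := by
    intro i j b b'
    have h1 := congrFun (congrFun hW (b, e i)) (b', e j)
    have h2 : (Matrix.of fun i' j' : A => Matrix.vecMulVec u (star u) (i', e i) (j', e j)) =
        Matrix.single i j (1 : ℂ) := by
      ext i' j'
      by_cases h : i = i' <;> by_cases h' : j = j' <;>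
        simp [u, Matrix.vecMulVec_apply, h, h', eq_comm]
    simp only [ampliation, Matrix.of_apply] at h1
    rw [h2, Matrix.mul_apply] at h1
    simpa only [Matrix.conjTranspose_apply] using h1
  refine ⟨fun r => Matrix.of fun b i => star (W r (b, e i)), fun ρ => ?_⟩
  ext b b'
  have hρ : Φ ρ = ∑ i, ∑ j, ρ i j • Φ (Matrix.single i j 1) := by
    conv_lhs => rw [Matrix.matrix_eq_sum_single ρ]
    simp only [map_sum]
    refine Finset.sum_congr rfl fun i _ => Finset.sum_congr rfl fun j _ => ?_
    rw [← map_smul, Matrix.smul_single, smul_eq_mul, mul_one]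
  rw [hρ]
  simp only [Matrix.sum_apply, Matrix.smul_apply, hchoi, smul_eq_mul, Matrix.mul_apply,
    Matrix.of_apply, Matrix.conjTranspose_apply, star_star, Finset.sum_mul, Finset.mul_sum]
  rw [Finset.sum_comm' (t' := Finset.univ) (s' := fun _ => Finset.univ) (by simp)]
  conv_rhs => rw [Finset.sum_comm]
  refine Finset.sum_congr rfl fun j _ => ?_
  rw [Finset.sum_comm]
  refine Finset.sum_congr rfl fun r _ => Finset.sum_congr rfl fun i _ => ?_
  ring

/-- The instrument followed by the correction, in Kraus form: the operators `A j`, of which those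
with label `label j = m` make up the map of outcome `m`. -/
structure KrausFamily {S S' M : Type*} [Fintype S] [DecidableEq S] [Fintype S'] [Fintype M]
    [DecidableEq M] (𝓘 : Instrument S S' M) (𝓔 : Channel (S' × M) S) where
  k : ℕ
  label : Fin k → M
  A : Fin k → Matrix S S ℂ
  map_flagged : ∀ m ρ, 𝓔.map (𝓘.flagged m ρ) = ∑ j, if label j = m then A j * ρ * (A j)ᴴ else 0
  sum_conjTranspose_mul : ∑ j, (A j)ᴴ * A j = 1

section

variable {S S' M : Type*} [Fintype S] [Fintype S'] [Fintype M] [DecidableEq M]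

theorem Instrument.trace_flagged (𝓘 : Instrument S S' M) (m : M) (ρ : Matrix S S ℂ) :
    (𝓘.flagged m ρ).trace = (𝓘.op m ρ).trace := by
  rw [Instrument.flagged, Matrix.trace_kronecker, Matrix.trace_single_eq_same, mul_one]

variable [DecidableEq S]

theorem exists_krausFamily (𝓘 : Instrument S S' M) (𝓔 : Channel (S' × M) S) :
    Nonempty (KrausFamily 𝓘 𝓔) := by
  classical
  choose B hB using fun m => (𝓘.completelyPositive m).exists_kraus
  obtain ⟨E, hE⟩ := 𝓔.completelyPositive.exists_kraus
  -- the embedding of the output system with the register in state `m`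
  let V : M → Matrix (S' × M) S' ℂ := fun m => Matrix.of fun p a => if p = (a, m) then 1 else 0
  have hV : ∀ m (σ : Matrix S' S' ℂ), σ ⊗ₖ Matrix.single m m (1 : ℂ) = V m * σ * (V m)ᴴ := by
    intro m σ
    ext ⟨a, n⟩ ⟨b, l⟩
    rw [Matrix.kroneckerMap_apply, Matrix.single_apply]
    simp only [V, Matrix.mul_apply, Matrix.of_apply, Matrix.conjTranspose_apply, Prod.mk.injEq]
    by_cases h1 : n = m <;> by_cases h2 : l = m <;>
      simp [h1, h2, eq_comm (a := m)]
  let J := M × (S' × Fin (Fintype.card S)) × (S × Fin (Fintype.card (S' × M)))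
  let A : J → Matrix S S ℂ := fun j => E j.2.2 * V j.1 * B j.1 j.2.1
  have hmap : ∀ m ρ, 𝓔.map (𝓘.flagged m ρ) =
      ∑ j : J, if j.1 = m then A j * ρ * (A j)ᴴ else 0 := by
    intro m ρ
    rw [Instrument.flagged, hV, hE, hB]
    symm
    rw [Fintype.sum_prod_type, Finset.sum_eq_single m, Fintype.sum_prod_type_right]
    · refine Finset.sum_congr rfl fun r _ => ?_
      simp only [if_true, A, Matrix.mul_sum, Matrix.sum_mul, Matrix.conjTranspose_mul,
        Matrix.mul_assoc]
    · intro m' _ h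
      simp [h]
    · simp
  have hsum : ∑ j, (A j)ᴴ * A j = 1 := by
    refine Matrix.ext_iff_trace_mul_right.2 fun ρ => ?_
    calc ((∑ j, (A j)ᴴ * A j) * ρ).trace = (∑ j, A j * ρ * (A j)ᴴ).trace := by
          rw [Matrix.sum_mul, Matrix.trace_sum, Matrix.trace_sum]
          refine Finset.sum_congr rfl fun j _ => ?_
          rw [Matrix.mul_assoc, Matrix.trace_mul_comm]
      _ = (∑ m, 𝓔.map (𝓘.flagged m ρ)).trace := by
          simp only [hmap]
          rw [Finset.sum_comm]
          simp
      _ = ρ.trace := by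
          rw [Matrix.trace_sum, ← 𝓘.trace_sum ρ, Matrix.trace_sum]
          refine Finset.sum_congr rfl fun m _ => ?_
          rw [𝓔.trace_map, 𝓘.trace_flagged]
      _ = _ := by rw [Matrix.one_mul]
  let e := Fintype.equivFin J
  refine ⟨⟨Fintype.card J, fun i => (e.symm i).1, fun i => A (e.symm i), fun m ρ => ?_, ?_⟩⟩
  · rw [hmap]
    exact (e.symm.sum_comp fun j => if j.1 = m then A j * ρ * (A j)ᴴ else 0).symm
  · rw [← hsum]
    exact e.symm.sum_comp fun j => (A j)ᴴ * A j

end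

/-! ### Noise and disturbance in terms of Kraus operators -/

theorem mul_ketbra_mul {S T : Type*} [Fintype S] (A : Matrix T S ℂ) (u : EuclideanSpace ℂ S) :
    A * ketbra u * Aᴴ = ketbra (WithLp.toLp 2 (A *ᵥ u.ofLp)) := by
  rw [ketbra, ketbra, Matrix.mul_vecMulVec, Matrix.vecMulVec_mul, ← Matrix.star_mulVec]

theorem trace_ketbra {S : Type*} [Fintype S] (u : EuclideanSpace ℂ S) :
    (ketbra u).trace = ((‖u‖ ^ 2 : ℝ) : ℂ) := by
  rw [ketbra, Matrix.trace_vecMulVec, ← EuclideanSpace.inner_eq_star_dotProduct,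
    inner_self_eq_norm_sq_to_K]
  simp

theorem star_dotProduct_ketbra_mulVec {S : Type*} [Fintype S] (u w : EuclideanSpace ℂ S) :
    star u.ofLp ⬝ᵥ (ketbra w *ᵥ u.ofLp) = ((‖inner ℂ u w‖ ^ 2 : ℝ) : ℂ) := by
  have h : star u.ofLp ⬝ᵥ (ketbra w *ᵥ u.ofLp) = inner ℂ u w * inner ℂ w u := by
    rw [ketbra, Matrix.vecMulVec_mulVec, op_smul_eq_smul, dotProduct_smul, smul_eq_mul,
      EuclideanSpace.inner_eq_star_dotProduct, EuclideanSpace.inner_eq_star_dotProduct,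
      dotProduct_comm w.ofLp, dotProduct_comm u.ofLp, mul_comm]
  rw [h, ← inner_conj_symm w u, Complex.mul_conj, Complex.normSq_eq_norm_sq]

theorem trace_ketbra_eq_sum {S : Type*} [Fintype S] (Z : OrthonormalBasis S ℂ (EuclideanSpace ℂ S))
    (w : EuclideanSpace ℂ S) :
    (ketbra w).trace = ((∑ z, ‖inner ℂ (Z z) w‖ ^ 2 : ℝ) : ℂ) := by
  rw [trace_ketbra, Z.sum_sq_norm_inner_right]

section

variable {S S' M : Type*} [Fintype S] [Fintype S'] [Fintype M] [DecidableEq M] [DecidableEq S]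
  {𝓘 : Instrument S S' M} {𝓔 : Channel (S' × M) S}

/-- The vectors `A_j† |φ^ẑ⟩`: the fine-grained outcome `(j, ẑ)` of the instrument, the correction
and a final measurement of the eigenstates of `Z` has the rank-one effect of this vector. -/
noncomputable def KrausFamily.vec (F : KrausFamily 𝓘 𝓔) (Z : Observable S) (p : Fin F.k × S) :
    EuclideanSpace ℂ S :=
  WithLp.toLp 2 ((F.A p.1)ᴴ *ᵥ (Z.eigenstate p.2).ofLp)

theorem KrausFamily.norm_inner_vec (F : KrausFamily 𝓘 𝓔) (Z : Observable S) (p : Fin F.k × S)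
    (u : EuclideanSpace ℂ S) :
    ‖inner ℂ u (F.vec Z p)‖ = ‖inner ℂ (Z.eigenstate p.2) (WithLp.toLp 2 (F.A p.1 *ᵥ u.ofLp))‖ := by
  rw [norm_inner_symm]
  congr 1
  rw [EuclideanSpace.inner_eq_star_dotProduct, EuclideanSpace.inner_eq_star_dotProduct, vec]
  simp only
  rw [Matrix.star_mulVec, Matrix.conjTranspose_conjTranspose, dotProduct_comm,
    ← Matrix.dotProduct_mulVec, dotProduct_comm]

theorem KrausFamily.noiseProb_eq (F : KrausFamily 𝓘 𝓔) (X Z : Observable S) (m : M) (x : S) :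
    noiseProb 𝓘 X m x = 1 / (Fintype.card S : ℝ) * ∑ p : Fin F.k × S,
      if F.label p.1 = m then ‖inner ℂ (X.eigenstate x) (F.vec Z p)‖ ^ 2 else 0 := by
  rw [noiseProb, ← 𝓘.trace_flagged, ← 𝓔.trace_map, F.map_flagged, Matrix.trace_sum, Complex.re_sum,
    Fintype.sum_prod_type]
  congr 1
  refine Finset.sum_congr rfl fun j _ => ?_
  split_ifs with h
  · rw [mul_ketbra_mul, trace_ketbra_eq_sum Z.eigenstate, Complex.ofReal_re]
    exact Finset.sum_congr rfl fun z _ => by rw [F.norm_inner_vec]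
  · simp

theorem KrausFamily.map_channel (F : KrausFamily 𝓘 𝓔) (ρ : Matrix S S ℂ) :
    𝓔.map (𝓘.channel ρ) = ∑ j, F.A j * ρ * (F.A j)ᴴ := by
  rw [Instrument.channel, map_sum]
  simp only [F.map_flagged]
  rw [Finset.sum_comm]
  simp

theorem KrausFamily.disturbanceProb_eq (F : KrausFamily 𝓘 𝓔) (Z : Observable S) (z' z : S) :
    disturbanceProb 𝓘 𝓔 Z z' z =
      1 / (Fintype.card S : ℝ) * ∑ j, ‖inner ℂ (Z.eigenstate z) (F.vec Z (j, z'))‖ ^ 2 := by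
  rw [disturbanceProb, F.map_channel, Matrix.sum_mulVec, dotProduct_sum, Complex.re_sum]
  congr 1
  refine Finset.sum_congr rfl fun j _ => ?_
  rw [mul_ketbra_mul, star_dotProduct_ketbra_mulVec, Complex.ofReal_re, F.norm_inner_vec]

theorem KrausFamily.noiseMSD_eq (F : KrausFamily 𝓘 𝓔) (X Z : Observable S) (f : M → ℝ) :
    noiseMSD 𝓘 X f = 1 / (Fintype.card S : ℝ) * ∑ p : Fin F.k × S, ∑ x,
      ‖inner ℂ (X.eigenstate x) (F.vec Z p)‖ ^ 2 * (f (F.label p.1) - X.eigenvalue x) ^ 2 := by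
  simp only [noiseMSD, F.noiseProb_eq X Z, Finset.mul_sum, Finset.sum_mul]
  rw [Finset.sum_congr rfl fun m _ => Finset.sum_comm, Finset.sum_comm]
  refine Finset.sum_congr rfl fun p _ => ?_
  rw [Finset.sum_comm]
  refine Finset.sum_congr rfl fun x _ => ?_
  rw [Finset.sum_eq_single (F.label p.1)]
  · rw [if_pos rfl, mul_assoc]
  · intro m _ h
    rw [if_neg (Ne.symm h), mul_zero, zero_mul]
  · simp

theorem KrausFamily.disturbanceMSD_eq (F : KrausFamily 𝓘 𝓔) (Z : Observable S) :
    disturbanceMSD 𝓘 𝓔 Z = 1 / (Fintype.card S : ℝ) * ∑ p : Fin F.k × S, ∑ z,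
      ‖inner ℂ (Z.eigenstate z) (F.vec Z p)‖ ^ 2 * (Z.eigenvalue p.2 - Z.eigenvalue z) ^ 2 := by
  simp only [disturbanceMSD, F.disturbanceProb_eq Z, Fintype.sum_prod_type_right, Finset.mul_sum,
    Finset.sum_mul]
  refine Finset.sum_congr rfl fun z' _ => ?_
  rw [Finset.sum_comm]
  simp only [mul_assoc]

/-- The effects of the fine-grained outcomes sum to the identity, which has trace `d`. -/
theorem KrausFamily.sum_norm_vec_sq (F : KrausFamily 𝓘 𝓔) (Z : Observable S) :
    ∑ p, ‖F.vec Z p‖ ^ 2 = Fintype.card S := by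
  have h1 : ∀ x, ∑ p : Fin F.k × S, ‖inner ℂ (Z.eigenstate x) (F.vec Z p)‖ ^ 2 = 1 := by
    intro x
    have : ((∑ p : Fin F.k × S, ‖inner ℂ (Z.eigenstate x) (F.vec Z p)‖ ^ 2 : ℝ) : ℂ) =
        (∑ j, F.A j * ketbra (Z.eigenstate x) * (F.A j)ᴴ).trace := by
      rw [Matrix.trace_sum, Fintype.sum_prod_type, Complex.ofReal_sum]
      refine Finset.sum_congr rfl fun j _ => ?_
      rw [mul_ketbra_mul, trace_ketbra_eq_sum Z.eigenstate]
      congr 1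
      exact Finset.sum_congr rfl fun z _ => by rw [F.norm_inner_vec]
    have h2 : (∑ j, F.A j * ketbra (Z.eigenstate x) * (F.A j)ᴴ).trace = 1 := by
      rw [Matrix.trace_sum, Finset.sum_congr rfl fun j _ => by
        rw [Matrix.mul_assoc, Matrix.trace_mul_comm, Matrix.mul_assoc], ← Matrix.trace_sum,
        ← Matrix.mul_sum, F.sum_conjTranspose_mul, mul_one, trace_ketbra,
        Z.eigenstate.norm_eq_one]
      simp
    rw [h2] at this
    exact_mod_cast this
  rw [Finset.sum_congr rfl fun p _ => (Z.eigenstate.sum_sq_norm_inner_right (F.vec Z p)).symm,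
    Finset.sum_comm]
  simp [h1]

theorem sq_le_mul_MSD [Nonempty S] (𝓘 : Instrument S S' M) (𝓔 : Channel (S' × M) S)
    (X Z : Observable S) (f : M → ℝ) {sX sZ : ℝ} (hX : X.HasSpacing sX) (hZ : Z.HasSpacing sZ) :
    (sX * sZ / (2 * Real.pi * Real.exp 1 * overlap X Z)) ^ 2 ≤
      (noiseMSD 𝓘 X f + sX ^ 2 / 12) * (disturbanceMSD 𝓘 𝓔 Z + sZ ^ 2 / 12) := by
  obtain ⟨F⟩ := exists_krausFamily 𝓘 𝓔
  rw [F.noiseMSD_eq X Z f, F.disturbanceMSD_eq Z]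
  have hd : (0 : ℝ) < Fintype.card S := by exact_mod_cast Fintype.card_pos
  have h := sq_le_mul_of_sum_norm_sq X Z hX hZ (fun p : Fin F.k × S => f (F.label p.1))
    (fun p => Z.eigenvalue p.2) (F.vec Z) hd (F.sum_norm_vec_sq Z)
  exact h

end

/-! ### Comparison with Ozawa's noise and disturbance -/

theorem trace_mul_partialTrace {S K : Type*} [Fintype S] [Fintype K] [DecidableEq K]
    (W : Matrix S S ℂ) (T : Matrix (S × K) (S × K) ℂ) :
    (W * partialTrace T).trace = ((W ⊗ₖ (1 : Matrix K K ℂ)) * T).trace := by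
  simp only [Matrix.trace, Matrix.diag_apply, Matrix.mul_apply, partialTrace, Matrix.of_apply,
    Fintype.sum_prod_type, Matrix.kroneckerMap_apply, Matrix.one_apply, Finset.mul_sum]
  refine Finset.sum_congr rfl fun i _ => ?_
  rw [Finset.sum_comm]
  simp [ite_mul, Finset.sum_ite_eq]

theorem Observable.ketbra_mul_ketbra {S : Type*} [Fintype S] [DecidableEq S] (X : Observable S)
    (x x' : S) : ketbra (X.eigenstate x) * ketbra (X.eigenstate x') =
      if x = x' then ketbra (X.eigenstate x) else 0 := by
  have h := X.eigenstate.inner_eq_ite x x'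
  rw [EuclideanSpace.inner_eq_star_dotProduct, dotProduct_comm] at h
  rw [ketbra, ketbra, Matrix.vecMulVec_mul_vecMulVec, h]
  split_ifs with hx
  · rw [hx, one_smul]
  · ext i j
    simp [Matrix.vecMulVec_apply]

theorem Observable.sum_ketbra {S : Type*} [Fintype S] [DecidableEq S] (X : Observable S) :
    ∑ x, ketbra (X.eigenstate x) = 1 := by
  refine Matrix.mulVec_injective (funext fun v => ?_)
  have h := congrArg WithLp.ofLp (X.eigenstate.sum_repr' (WithLp.toLp 2 v))
  rw [WithLp.ofLp_sum] at h
  rw [Matrix.sum_mulVec, Matrix.one_mulVec]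
  refine Eq.trans (Finset.sum_congr rfl fun x _ => ?_) h
  rw [ketbra, Matrix.vecMulVec_mulVec, op_smul_eq_smul, WithLp.ofLp_smul,
    EuclideanSpace.inner_eq_star_dotProduct, dotProduct_comm]

theorem Observable.toMatrix_mul_self {S : Type*} [Fintype S] [DecidableEq S] (X : Observable S) :
    X.toMatrix * X.toMatrix = ∑ x, ((X.eigenvalue x : ℂ) ^ 2) • ketbra (X.eigenstate x) := by
  simp only [toMatrix, Matrix.sum_mul, Matrix.mul_sum, Matrix.smul_mul, Matrix.mul_smul,
    X.ketbra_mul_ketbra, smul_ite, smul_zero, Finset.sum_ite_eq',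
    Finset.mem_univ, if_true, smul_smul, sq]

namespace MeasuringProcess

variable {S M K : Type*} [Fintype S] [DecidableEq S] [Fintype M] [DecidableEq M] [Fintype K]
  [DecidableEq K]

/-- The state of system and probe after the interaction. -/
def evolved (P : MeasuringProcess S M K) (ρ : Matrix S S ℂ) : Matrix (S × K) (S × K) ℂ :=
  P.U * (ρ ⊗ₖ P.probe) * P.Uᴴ

theorem trace_mul_op (P : MeasuringProcess S M K) (m : M) (W ρ : Matrix S S ℂ) :
    (W * P.op m ρ).trace = ((W ⊗ₖ P.meter m) * P.evolved ρ).trace := by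
  have hm : P.meter m * P.meter m = P.meter m := by rw [P.meter_mul, if_pos rfl]
  have hop : P.op m ρ = partialTrace (((1 : Matrix S S ℂ) ⊗ₖ P.meter m) * P.evolved ρ *
      ((1 : Matrix S S ℂ) ⊗ₖ P.meter m)) := by
    simp only [op, evolved, Matrix.mul_assoc]
  rw [hop, trace_mul_partialTrace, ← Matrix.mul_assoc, Matrix.trace_mul_comm, ← Matrix.mul_assoc,
    ← Matrix.mul_assoc, ← Matrix.mul_kronecker_mul, ← Matrix.mul_kronecker_mul, Matrix.one_mul,
    Matrix.mul_one, Matrix.mul_one, hm]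

/-- The mean square of `U† G U - X ⊗ 1` in the maximally mixed state. The cross terms agree because
`X` commutes with the maximally mixed state. -/
theorem trace_sq_sub_mul_maximallyMixed (P : MeasuringProcess S M K)
    (G : Matrix (S × K) (S × K) ℂ) (X : Matrix S S ℂ) :
    ((P.Uᴴ * G * P.U - X ⊗ₖ (1 : Matrix K K ℂ)) ^ 2 * (maximallyMixed S ⊗ₖ P.probe)).trace =
      (Fintype.card S : ℂ)⁻¹ * ((G * G * P.evolved 1).trace - 2 * (G * P.evolved X).trace +
        (X * X).trace) := by
  have hU : P.U * P.Uᴴ = 1 := Matrix.mem_unitaryGroup_iff.1 P.U_unitary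
  set Y : Matrix (S × K) (S × K) ℂ := X ⊗ₖ (1 : Matrix K K ℂ) with hY
  set τ : Matrix (S × K) (S × K) ℂ := (1 : Matrix S S ℂ) ⊗ₖ P.probe with hτ
  have hYτ : Y * τ = X ⊗ₖ P.probe := by
    rw [hY, hτ, ← Matrix.mul_kronecker_mul, Matrix.mul_one, Matrix.one_mul]
  have hτY : τ * Y = X ⊗ₖ P.probe := by
    rw [hY, hτ, ← Matrix.mul_kronecker_mul, Matrix.mul_one, Matrix.one_mul]
  have h1 : (P.Uᴴ * G * P.U * (P.Uᴴ * G * P.U) * τ).trace = (G * G * P.evolved 1).trace := by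
    have : P.Uᴴ * G * P.U * (P.Uᴴ * G * P.U) * τ = P.Uᴴ * (G * G * P.U * τ) := by
      calc _ = P.Uᴴ * G * (P.U * P.Uᴴ) * G * P.U * τ := by simp only [Matrix.mul_assoc]
        _ = _ := by rw [hU, Matrix.mul_one]; simp only [Matrix.mul_assoc]
    rw [this, Matrix.trace_mul_comm, evolved, hτ]
    simp only [Matrix.mul_assoc]
  have h2 : (P.Uᴴ * G * P.U * Y * τ).trace = (G * P.evolved X).trace := by
    rw [Matrix.mul_assoc _ Y, hYτ, evolved]
    simp only [Matrix.mul_assoc]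
    rw [Matrix.trace_mul_comm]
    simp only [Matrix.mul_assoc]
  have h3 : (Y * (P.Uᴴ * G * P.U) * τ).trace = (G * P.evolved X).trace := by
    rw [Matrix.mul_assoc, Matrix.trace_mul_comm, Matrix.mul_assoc, hτY, ← h2,
      Matrix.mul_assoc _ Y, hYτ]
  have h4 : (Y * Y * τ).trace = (X * X).trace := by
    rw [Matrix.mul_assoc, hYτ, hY, ← Matrix.mul_kronecker_mul, Matrix.trace_kronecker,
      Matrix.one_mul, P.probe_trace, mul_one]
  have hmm : maximallyMixed S ⊗ₖ P.probe = (Fintype.card S : ℂ)⁻¹ • τ := by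
    rw [maximallyMixed, Matrix.smul_kronecker]
  rw [hmm, Matrix.mul_smul, Matrix.trace_smul, smul_eq_mul, sq, Matrix.sub_mul, Matrix.mul_sub,
    Matrix.mul_sub, Matrix.sub_mul, Matrix.sub_mul, Matrix.sub_mul, Matrix.trace_sub,
    Matrix.trace_sub, Matrix.trace_sub, h1, h2, h3, h4]
  ring

variable {S' : Type*} [Fintype S'] {𝓘 : Instrument S S' M} {𝓔 : Channel (S' × M) S}

theorem trace_one_kronecker_mul_evolved (P : MeasuringProcess S M K) (hP : P.HasStatisticsOf 𝓘)
    (g : M → ℂ) (ρ : Matrix S S ℂ) :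
    (((1 : Matrix S S ℂ) ⊗ₖ ∑ m, g m • P.meter m) * P.evolved ρ).trace =
      ∑ m, g m * (𝓘.op m ρ).trace := by
  have h : ((1 : Matrix S S ℂ) ⊗ₖ ∑ m, g m • P.meter m) =
      ∑ m, g m • ((1 : Matrix S S ℂ) ⊗ₖ P.meter m) := by
    ext ⟨i, k⟩ ⟨j, l⟩
    simp only [Matrix.kroneckerMap_apply, Matrix.sum_apply, Matrix.smul_apply, smul_eq_mul,
      Finset.mul_sum]
    exact Finset.sum_congr rfl fun m _ => by ring
  rw [h, Matrix.sum_mul, Matrix.trace_sum]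
  refine Finset.sum_congr rfl fun m _ => ?_
  rw [Matrix.smul_mul, Matrix.trace_smul, ← P.trace_mul_op, Matrix.one_mul, hP, smul_eq_mul]

theorem meterObservable_mul_self (P : MeasuringProcess S M K) (f : M → ℝ) :
    P.meterObservable f * P.meterObservable f = ∑ m, ((f m : ℂ) ^ 2) • P.meter m := by
  simp only [meterObservable, Matrix.sum_mul, Matrix.mul_sum, Matrix.smul_mul, Matrix.mul_smul,
    P.meter_mul, smul_ite, smul_zero, Finset.sum_ite_eq', Finset.mem_univ,
    if_true, smul_smul, sq]

theorem noiseMSD_eq_ozawaNoise_sq (P : MeasuringProcess S M K) (hP : P.HasStatisticsOf 𝓘)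
    (𝓔 : Channel (S' × M) S) (X : Observable S) (f : M → ℝ) :
    noiseMSD 𝓘 X f = P.ozawaNoise f X.toMatrix (maximallyMixed S) ^ 2 := by
  have hkey : noiseMSD 𝓘 X f =
      (P.noiseOperator f X.toMatrix ^ 2 * (maximallyMixed S ⊗ₖ P.probe)).trace.re := by
    -- `Tr X² = ∑ m, Tr 𝓘^m(X²)` makes all three terms sums over `m` and `x`
    rw [noiseOperator, trace_sq_sub_mul_maximallyMixed, ← Matrix.mul_kronecker_mul, Matrix.one_mul,
      meterObservable_mul_self, P.trace_one_kronecker_mul_evolved hP, meterObservable,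
      P.trace_one_kronecker_mul_evolved hP, ← 𝓘.trace_sum (X.toMatrix * X.toMatrix),
      X.toMatrix_mul_self, ← X.sum_ketbra, Observable.toMatrix, Matrix.trace_sum]
    simp only [map_sum, map_smul, Matrix.trace_sum, Matrix.trace_smul, smul_eq_mul]
    simp only [noiseMSD, noiseProb, Finset.mul_sum, ← Finset.sum_sub_distrib,
      ← Finset.sum_add_distrib, Complex.re_sum]
    refine Finset.sum_congr rfl fun m _ => Finset.sum_congr rfl fun x _ => ?_
    generalize (𝓘.op m (ketbra (X.eigenstate x))).trace = t
    have : (Fintype.card S : ℂ)⁻¹ * ((f m : ℂ) ^ 2 * t - 2 * ((f m : ℂ) * ((X.eigenvalue x : ℂ) * t))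
        + (X.eigenvalue x : ℂ) ^ 2 * t) =
        (((Fintype.card S : ℝ)⁻¹ * (f m - X.eigenvalue x) ^ 2 : ℝ) : ℂ) * t := by
      push_cast; ring
    rw [this, Complex.re_ofReal_mul]
    ring
  have hnonneg : 0 ≤ noiseMSD 𝓘 X f := by
    obtain ⟨F⟩ := exists_krausFamily 𝓘 𝓔
    rw [F.noiseMSD_eq X X f]
    positivity
  rw [ozawaNoise, Real.sq_sqrt (hkey ▸ hnonneg), hkey]

theorem trace_kronecker_one_mul_evolved (P : MeasuringProcess S M K) (hP : P.HasChannelOf 𝓘 𝓔)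
    (W ρ : Matrix S S ℂ) :
    ((W ⊗ₖ (1 : Matrix K K ℂ)) * P.evolved ρ).trace = (W * 𝓔.map (𝓘.channel ρ)).trace := by
  rw [← hP, Matrix.mul_sum, Matrix.trace_sum, ← P.meter_sum]
  simp only [P.trace_mul_op]
  rw [← Matrix.trace_sum, ← Matrix.sum_mul]
  congr 2
  ext ⟨i, k⟩ ⟨j, l⟩
  simp only [Matrix.kroneckerMap_apply, Matrix.sum_apply, Finset.mul_sum]

theorem disturbanceMSD_eq_ozawaDisturbance_sq (P : MeasuringProcess S M K)
    (hP : P.HasChannelOf 𝓘 𝓔) (Z : Observable S) :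
    disturbanceMSD 𝓘 𝓔 Z = P.ozawaDisturbance Z.toMatrix (maximallyMixed S) ^ 2 := by
  obtain ⟨F⟩ := exists_krausFamily 𝓘 𝓔
  have hlin : IsLinearMap ℂ fun ρ => 𝓔.map (𝓘.channel ρ) := by
    simp only [F.map_channel]
    constructor
    · intro ρ τ
      simp only [Matrix.mul_add, Matrix.add_mul, Finset.sum_add_distrib]
    · intro c ρ
      simp only [Matrix.mul_smul, Matrix.smul_mul, Finset.smul_sum]
  set T := hlin.mk' with hT
  have hTa : ∀ ρ, 𝓔.map (𝓘.channel ρ) = T ρ := fun _ => rfl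
  have htr : ∀ ρ, (T ρ).trace = ρ.trace := by
    intro ρ
    rw [← hTa, 𝓔.trace_map, Instrument.channel, ← 𝓘.trace_sum ρ, Matrix.trace_sum, Matrix.trace_sum]
    exact Finset.sum_congr rfl fun m _ => 𝓘.trace_flagged m ρ
  have hexp : ∀ (u : EuclideanSpace ℂ S) (Y : Matrix S S ℂ),
      (ketbra u * Y).trace = star u.ofLp ⬝ᵥ (Y *ᵥ u.ofLp) := by
    intro u Y
    rw [Matrix.trace_mul_comm, ketbra, Matrix.mul_vecMulVec, Matrix.trace_vecMulVec, dotProduct_comm]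
  have hkey : disturbanceMSD 𝓘 𝓔 Z =
      (P.disturbanceOperator Z.toMatrix ^ 2 * (maximallyMixed S ⊗ₖ P.probe)).trace.re := by
    -- trace preservation makes all three terms sums over `ẑ` and `z`
    have hsq : (Z.toMatrix * Z.toMatrix).trace =
        (1 * T (Z.toMatrix * Z.toMatrix)).trace := by rw [Matrix.one_mul, htr]
    rw [disturbanceOperator, trace_sq_sub_mul_maximallyMixed, ← Matrix.mul_kronecker_mul,
      Matrix.one_mul, P.trace_kronecker_one_mul_evolved hP, P.trace_kronecker_one_mul_evolved hP,
      hTa, hTa, hsq, Z.toMatrix_mul_self, ← Z.sum_ketbra, Observable.toMatrix]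
    simp only [map_sum, map_smul, Matrix.sum_mul, Matrix.mul_sum, Matrix.smul_mul, Matrix.mul_smul,
      Matrix.trace_sum, Matrix.trace_smul, smul_eq_mul, hexp]
    simp only [disturbanceMSD, disturbanceProb, hTa, Finset.mul_sum]
    rw [Finset.sum_comm]
    simp only [← Finset.sum_sub_distrib, ← Finset.sum_add_distrib, Finset.mul_sum, Complex.re_sum]
    refine Finset.sum_congr rfl fun z _ => Finset.sum_congr rfl fun z' _ => ?_
    generalize star (Z.eigenstate z').ofLp ⬝ᵥ
      (T (ketbra (Z.eigenstate z)) *ᵥ (Z.eigenstate z').ofLp) = t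
    have : (Fintype.card S : ℂ)⁻¹ * ((Z.eigenvalue z' : ℂ) ^ 2 * t -
        2 * ((Z.eigenvalue z : ℂ) * ((Z.eigenvalue z' : ℂ) * t)) + (Z.eigenvalue z : ℂ) ^ 2 * t) =
        (((Fintype.card S : ℝ)⁻¹ * (Z.eigenvalue z' - Z.eigenvalue z) ^ 2 : ℝ) : ℂ) * t := by
      push_cast; ring
    rw [this, Complex.re_ofReal_mul]
    ring
  have hnonneg : 0 ≤ disturbanceMSD 𝓘 𝓔 Z := by
    rw [F.disturbanceMSD_eq Z]
    positivity
  rw [ozawaDisturbance, Real.sq_sqrt (hkey ▸ hnonneg), hkey]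

/-! ### Existence of a realising measuring process -/

theorem exists_unitary_of_isometry {S : Type*} [Fintype S] [DecidableEq S] {k : ℕ}
    (A : Fin k → Matrix S S ℂ) (hA : ∑ j, (A j)ᴴ * A j = 1) (k₀ : Fin k) :
    ∃ U ∈ Matrix.unitaryGroup (S × Fin k) ℂ, ∀ s j a, U (s, j) (a, k₀) = A j s a := by
  let v : S × Fin k → EuclideanSpace ℂ (S × Fin k) := fun q =>
    WithLp.toLp 2 fun p => A p.2 p.1 q.1
  have hv : Orthonormal ℂ (Set.domRestrict {q : S × Fin k | q.2 = k₀} v) := by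
    rw [orthonormal_iff_ite]
    rintro ⟨⟨a, l⟩, rfl⟩ ⟨⟨b, l'⟩, hl⟩
    obtain rfl : l' = l := hl
    have h := congrFun (congrFun hA a) b
    rw [Matrix.sum_apply, Matrix.one_apply] at h
    simp only [Matrix.mul_apply, Matrix.conjTranspose_apply] at h
    rw [EuclideanSpace.inner_eq_star_dotProduct]
    simp only [Set.domRestrict_apply, v, dotProduct, Fintype.sum_prod_type_right, Pi.star_apply]
    simp only [Subtype.mk.injEq, Prod.mk.injEq, and_true]
    rw [← h]
    exact Finset.sum_congr rfl fun j _ => Finset.sum_congr rfl fun s _ => mul_comm _ _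
  obtain ⟨b, hb⟩ := hv.exists_orthonormalBasis_extension_of_card_eq (by simp)
  refine ⟨Matrix.of fun p q => b q p, ?_, fun s j a => ?_⟩
  · rw [Matrix.mem_unitaryGroup_iff']
    ext p q
    have h := b.inner_eq_ite p q
    rw [EuclideanSpace.inner_eq_star_dotProduct, dotProduct_comm] at h
    rw [Matrix.one_apply, ← h]
    rfl
  · rw [Matrix.of_apply, hb (a, k₀) rfl]

/-- The dilation of a Kraus family: the probe starts in a basis state, the interaction writes the
index of the Kraus operator into the probe, and the meter reads off its label. -/
theorem exists_realises [Nonempty S] (𝓘 : Instrument S S' M) (𝓔 : Channel (S' × M) S) :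
    ∃ (k : ℕ) (P : MeasuringProcess S M (Fin k)), P.Realises 𝓘 𝓔 := by
  obtain ⟨F⟩ := exists_krausFamily 𝓘 𝓔
  obtain ⟨k₀⟩ : Nonempty (Fin F.k) := by
    by_contra h
    rw [not_nonempty_iff] at h
    have := F.sum_conjTranspose_mul
    rw [Finset.univ_eq_empty, Finset.sum_empty] at this
    exact zero_ne_one this
  obtain ⟨U, hU, hUA⟩ := exists_unitary_of_isometry F.A F.sum_conjTranspose_mul k₀
  refine ⟨F.k, {
    probe := Matrix.diagonal (Pi.single k₀ 1)
    probe_posSemidef := Matrix.PosSemidef.diagonal (Pi.single_nonneg.2 zero_le_one)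
    probe_trace := by simp [Matrix.trace_diagonal]
    U := U
    U_unitary := hU
    meter := fun m => Matrix.diagonal fun j => if F.label j = m then 1 else 0
    meter_isHermitian := fun m => by
      rw [Matrix.isHermitian_diagonal_iff]
      intro j
      split_ifs
      · exact IsSelfAdjoint.one _
      · exact IsSelfAdjoint.zero _
    meter_mul := fun m m' => by
      rw [Matrix.diagonal_mul_diagonal]
      split_ifs with h
      · subst h; congr 1; ext j; simp
      · rw [← Matrix.diagonal_zero]
        congr 1
        ext j
        by_cases h1 : F.label j = m
        · simp [h1, h]
        · simp [h1]
    meter_sum := by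
      ext i j
      rw [Matrix.sum_apply]
      by_cases h : i = j
      · subst h; simp
      · simp [h] }, fun m ρ => ?_⟩
  rw [F.map_flagged]
  ext s t
  have hdiag : ∀ d : Fin F.k → ℂ, (1 : Matrix S S ℂ) ⊗ₖ Matrix.diagonal d =
      Matrix.diagonal fun p => d p.2 := by
    intro d
    rw [← Matrix.diagonal_one, Matrix.diagonal_kronecker_diagonal]
    simp
  simp only [op, partialTrace, hdiag, Matrix.of_apply, Matrix.mul_diagonal, Matrix.mul_assoc,
    Matrix.diagonal_mul, Matrix.sum_apply]
  refine Finset.sum_congr rfl fun j _ => ?_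
  by_cases h : F.label j = m
  · simp only [h, if_true, one_mul, mul_one, Matrix.mul_apply, Fintype.sum_prod_type,
      Matrix.kroneckerMap_apply, Matrix.conjTranspose_apply, Matrix.diagonal_apply, Pi.single_apply]
    simp only [mul_ite, mul_one, mul_zero, ite_mul, zero_mul, Finset.sum_ite_eq,
      Finset.mem_univ, if_true]
    simp [hUA]
  · simp [h]

theorem Realises.hasStatisticsOf {P : MeasuringProcess S M K} (hP : P.Realises 𝓘 𝓔) :
    P.HasStatisticsOf 𝓘 := fun m ρ => by
  rw [hP, 𝓔.trace_map, 𝓘.trace_flagged]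

theorem Realises.hasChannelOf {P : MeasuringProcess S M K} (hP : P.Realises 𝓘 𝓔) :
    P.HasChannelOf 𝓘 𝓔 := fun ρ => by
  rw [Instrument.channel, map_sum]
  exact Finset.sum_congr rfl fun m _ => hP m ρ

end MeasuringProcess

/-! ### Pauli observables of a qubit -/

theorem Observable.toMatrix_mulVec {S : Type*} [Fintype S] [DecidableEq S] (X : Observable S)
    (x : S) :
    X.toMatrix *ᵥ (X.eigenstate x).ofLp = (X.eigenvalue x : ℂ) • (X.eigenstate x).ofLp := by
  rw [toMatrix, Matrix.sum_mulVec, Finset.sum_eq_single x]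
  · have h := X.eigenstate.inner_eq_ite x x
    rw [if_pos rfl, EuclideanSpace.inner_eq_star_dotProduct, dotProduct_comm] at h
    rw [Matrix.smul_mulVec, ketbra, Matrix.vecMulVec_mulVec, h, MulOpposite.op_one, one_smul]
  · intro x' _ hx
    have h := X.eigenstate.inner_eq_ite x' x
    rw [if_neg hx, EuclideanSpace.inner_eq_star_dotProduct, dotProduct_comm] at h
    rw [Matrix.smul_mulVec, ketbra, Matrix.vecMulVec_mulVec, h, MulOpposite.op_zero, zero_smul,
      smul_zero]
  · simp

/-- An observable whose square is the identity has eigenvalues `±1`. -/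
theorem Observable.eigenvalue_sq_eq_one {S : Type*} [Fintype S] [DecidableEq S] (X : Observable S)
    (hX : X.toMatrix * X.toMatrix = 1) (x : S) : X.eigenvalue x ^ 2 = 1 := by
  have h : ((X.eigenvalue x : ℂ) * X.eigenvalue x) • (X.eigenstate x).ofLp =
      (1 : ℂ) • (X.eigenstate x).ofLp := by
    rw [mul_smul, ← X.toMatrix_mulVec, ← Matrix.mulVec_smul, ← X.toMatrix_mulVec,
      Matrix.mulVec_mulVec, hX, Matrix.one_mulVec, one_smul]
  have hne : (X.eigenstate x).ofLp ≠ 0 := fun h0 =>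
    X.eigenstate.toBasis.ne_zero x (by
      rw [OrthonormalBasis.coe_toBasis]
      exact (WithLp.ofLp_eq_zero 2).1 h0)
  have h2 := smul_left_injective ℂ hne h
  rw [sq]
  exact_mod_cast h2

theorem pauliX_mul_self : pauliX * pauliX = 1 := by
  ext i j; fin_cases i <;> fin_cases j <;> simp [pauliX]

theorem pauliZ_mul_self : pauliZ * pauliZ = 1 := by
  ext i j; fin_cases i <;> fin_cases j <;> simp [pauliZ]

/-- The eigenbases of `σ_X` and `σ_Z` are mutually unbiased. -/
theorem norm_inner_sq_of_pauli (X Z : Observable (Fin 2)) (hX : X.toMatrix = pauliX)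
    (hZ : Z.toMatrix = pauliZ) (x z : Fin 2) :
    ‖inner ℂ (Z.eigenstate z) (X.eigenstate x)‖ ^ 2 = 1 / 2 := by
  have hξ := X.eigenvalue_sq_eq_one (by rw [hX, pauliX_mul_self]) x
  have h1 := X.toMatrix_mulVec x
  have h2 := Z.toMatrix_mulVec z
  have h3 := X.eigenstate.norm_eq_one x
  have h4 := Z.eigenstate.norm_eq_one z
  have hζ := Z.eigenvalue_sq_eq_one (by rw [hZ, pauliZ_mul_self]) z
  rw [hX] at h1
  rw [hZ] at h2
  generalize X.eigenstate x = ψ at *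
  generalize Z.eigenstate z = φ at *
  generalize X.eigenvalue x = ξ at *
  generalize Z.eigenvalue z = ζ at *
  rw [EuclideanSpace.norm_eq, Real.sqrt_eq_one, Fin.sum_univ_two] at h3 h4
  have a0 := congrFun h1 0
  have b0 := congrFun h2 0
  have b1 := congrFun h2 1
  simp [pauliX, Matrix.mulVec, dotProduct] at a0
  simp [pauliZ, Matrix.mulVec, dotProduct] at b0 b1
  have hn : ‖ψ 1‖ ^ 2 = ‖ψ 0‖ ^ 2 := by
    rw [a0, norm_mul, mul_pow, Complex.norm_real, Real.norm_eq_abs, sq_abs, hξ, one_mul]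
  have hψ0 : ‖ψ 0‖ ^ 2 = 1 / 2 := by linarith
  have hψ1 : ‖ψ 1‖ ^ 2 = 1 / 2 := by linarith
  rw [EuclideanSpace.inner_eq_star_dotProduct, dotProduct, Fin.sum_univ_two]
  rcases mul_self_eq_one_iff.1 ((sq ζ).symm.trans hζ) with h | h
  · have hφ : φ 1 = 0 := by
      rw [h, Complex.ofReal_one] at b1
      linear_combination -(1 / 2 : ℂ) * b1
    rw [hφ, norm_zero, sq (0 : ℝ), mul_zero, add_zero] at h4
    rw [Pi.star_apply, Pi.star_apply, hφ, star_zero, mul_zero, add_zero, norm_mul, norm_star,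
      mul_pow, hψ0, h4, mul_one]
  · have hφ : φ 0 = 0 := by
      rw [h, Complex.ofReal_neg, Complex.ofReal_one] at b0
      linear_combination (1 / 2 : ℂ) * b0
    rw [hφ, norm_zero, sq (0 : ℝ), mul_zero, zero_add] at h4
    rw [Pi.star_apply, Pi.star_apply, hφ, star_zero, mul_zero, zero_add, norm_mul, norm_star,
      mul_pow, hψ1, h4, mul_one]

theorem disturbanceMSD_eq_two_of_pauli {S' M : Type*} [Fintype S'] [Fintype M] [DecidableEq M]
    (𝓘 : Instrument (Fin 2) S' M) (𝓔 : Channel (S' × M) (Fin 2)) (X Z : Observable (Fin 2))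
    (f : M → ℝ) (hX : X.toMatrix = pauliX) (hZ : Z.toMatrix = pauliZ)
    (h0 : noiseMSD 𝓘 X f = 0) : disturbanceMSD 𝓘 𝓔 Z = 2 := by
  obtain ⟨F⟩ := exists_krausFamily 𝓘 𝓔
  have hzero : ∀ p x, ‖inner ℂ (X.eigenstate x) (F.vec Z p)‖ ^ 2 *
      (f (F.label p.1) - X.eigenvalue x) ^ 2 = 0 := by
    rw [F.noiseMSD_eq X Z f, mul_eq_zero, or_iff_right (by simp),
      Finset.sum_eq_zero_iff_of_nonneg fun p _ => by positivity] at h0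
    intro p x
    have := h0 p (Finset.mem_univ p)
    rw [Finset.sum_eq_zero_iff_of_nonneg fun x _ => by positivity] at this
    exact this x (Finset.mem_univ x)
  -- no effect overlaps both eigenstates of `X`, so each is proportional to one of them
  have hprop : ∀ p, ∃ x, ∃ c : ℂ, F.vec Z p = c • X.eigenstate x := by
    intro p
    obtain ⟨x, hx⟩ : ∃ x, inner ℂ (X.eigenstate (x + 1)) (F.vec Z p) = 0 := by
      by_contra! hne
      have h1 : ∀ x, f (F.label p.1) = X.eigenvalue x := by
        intro x
        have := hzero p x
        have hnx := hne (x + 1)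
        rw [show x + 1 + 1 = x by fin_cases x <;> rfl] at hnx
        rw [mul_eq_zero, or_iff_right (pow_ne_zero 2 (norm_ne_zero_iff.2 hnx)), sq_eq_zero_iff,
          sub_eq_zero] at this
        exact this
      exact zero_ne_one (X.nondegenerate ((h1 0).symm.trans (h1 1)))
    refine ⟨x, inner ℂ (X.eigenstate x) (F.vec Z p), ?_⟩
    have hs := X.eigenstate.sum_repr' (F.vec Z p)
    rw [Fintype.sum_eq_add x (x + 1) (by fin_cases x <;> simp)
      (by rintro y ⟨h1, h2⟩; revert h1 h2; fin_cases x <;> fin_cases y <;> simp), hx, zero_smul,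
      add_zero] at hs
    exact hs.symm
  have hhalf : ∀ p z, ‖inner ℂ (Z.eigenstate z) (F.vec Z p)‖ ^ 2 = 1 / 2 * ‖F.vec Z p‖ ^ 2 := by
    intro p z
    obtain ⟨x, c, hc⟩ := hprop p
    rw [hc, inner_smul_right, norm_mul, mul_pow, norm_inner_sq_of_pauli X Z hX hZ, norm_smul,
      X.eigenstate.norm_eq_one]
    ring
  have hgap : ∀ z', ∑ z, (Z.eigenvalue z' - Z.eigenvalue z) ^ 2 = 4 := by
    have hsq := Z.eigenvalue_sq_eq_one (by rw [hZ, pauliZ_mul_self])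
    have hne : Z.eigenvalue 0 ≠ Z.eigenvalue 1 := fun h => zero_ne_one (Z.nondegenerate h)
    have hopp : Z.eigenvalue 0 = -Z.eigenvalue 1 :=
      (sq_eq_sq_iff_eq_or_eq_neg.1 ((hsq 0).trans (hsq 1).symm)).resolve_left hne
    have h1 := hsq 1
    intro z'
    fin_cases z' <;> simp [Fin.sum_univ_two, hopp] <;> nlinarith
  rw [F.disturbanceMSD_eq Z]
  simp only [hhalf, ← Finset.mul_sum, hgap]
  rw [← Finset.sum_mul, ← Finset.mul_sum, F.sum_norm_vec_sq Z]
  norm_num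

end NoiseDisturbance

theorem mainTheorem5 {S' M : Type*} [Fintype S'] [Fintype M] [DecidableEq M] :
    (∀ {S : Type*} [Fintype S] [DecidableEq S] [Nonempty S]
        (𝓘 : Instrument S S' M) (𝓔 : Channel (S' × M) S) (X Z : Observable S) (f : M → ℝ),
      -- the tradeoff relation
      (∀ sX sZ : ℝ, X.HasSpacing sX → Z.HasSpacing sZ →
        (sX * sZ / (2 * Real.pi * Real.exp 1 * overlap X Z)) ^ 2 ≤
          (noiseMSD 𝓘 X f + sX ^ 2 / 12) * (disturbanceMSD 𝓘 𝓔 Z + sZ ^ 2 / 12)) ∧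
      -- comparison with Ozawa's noise and disturbance in the maximally mixed state
      (∀ {K : Type*} [Fintype K] [DecidableEq K] (P : MeasuringProcess S M K),
        (P.HasStatisticsOf 𝓘 →
          noiseMSD 𝓘 X f = P.ozawaNoise f X.toMatrix (maximallyMixed S) ^ 2) ∧
        (P.HasChannelOf 𝓘 𝓔 →
          disturbanceMSD 𝓘 𝓔 Z = P.ozawaDisturbance Z.toMatrix (maximallyMixed S) ^ 2)) ∧
      (∃ (k : ℕ) (P : MeasuringProcess S M (Fin k)),
        P.Realises 𝓘 𝓔 ∧ P.HasStatisticsOf 𝓘 ∧ P.HasChannelOf 𝓘 𝓔)) ∧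
    -- Pauli observables of a qubit
    (∀ (𝓘 : Instrument (Fin 2) S' M) (𝓔 : Channel (S' × M) (Fin 2)) (X Z : Observable (Fin 2))
        (f : M → ℝ), X.toMatrix = pauliX → Z.toMatrix = pauliZ →
      noiseMSD 𝓘 X f = 0 → disturbanceMSD 𝓘 𝓔 Z = 2) := by
  refine ⟨fun {S} _ _ _ 𝓘 𝓔 X Z f => ⟨fun sX sZ hX hZ => sq_le_mul_MSD 𝓘 𝓔 X Z f hX hZ,
    fun P => ⟨fun hP => P.noiseMSD_eq_ozawaNoise_sq hP 𝓔 X f,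
      fun hP => P.disturbanceMSD_eq_ozawaDisturbance_sq hP Z⟩, ?_⟩,
    fun 𝓘 𝓔 X Z f hX hZ h0 => disturbanceMSD_eq_two_of_pauli 𝓘 𝓔 X Z f hX hZ h0⟩
  obtain ⟨k, P, hP⟩ := MeasuringProcess.exists_realises 𝓘 𝓔
  exact ⟨k, P, hP, hP.hasStatisticsOf, hP.hasChannelOf⟩
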